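/- Let $d,m$ be nonnegative integers, and let $|\cdot|$ be the Euclidean norm. Let $\mathcal P(\mathbb R^d)$ be the set of Borel probability measures on $\mathbb R^d$, and let $\mathcal P_1(\mathbb R^d)$ be the subset of those $\mu$ with $\|\mu\|_1:=\int|x|\,\mu(dx)<\infty$. Let $\mathcal W_1(\mu,\nu)=\inf E|X-Y|$, the infimum being over all pairs of $\mathbb R^d$-valued random variables $X,Y$ on a common probability space with laws $\mu$ and $\nu$. Let $A$ be a real $d\times d$ matrix, $\delta>0$, $\theta$ a probability measure on $\mathbb R^m$, $f:\mathbb R^d\times\mathcal P(\mathbb R^d)\times\mathbb R^m\to\mathbb R^d$ a measurable map, and $\mu_0\in\mathcal P_1(\mathbb R^d)$. For $\mu\in\mathcal P(\mathbb R^d)$ let $\Psi(\mu)$ be the law of $AX+\delta f(X,\mu,\epsilon)$, where $(X,\epsilon)$ has law $\mu\otimes\theta$, and put $\mu_{n+1}=\Psi(\mu_n)$ for $n\ge 0$. For every $N\ge 1$ let $X_0^{1,N},\dots,X_0^{N,N}$ be exchangeable random variables with common law $\mu_0$, and let $\{\epsilon_n^{i}: 1\le i\le N,\ n\ge1\}$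 be i.i.d. random variables with law $\theta$, independent of $(X_0^{1,N},\dots,X_0^{N,N})$. Define for $n\ge 0$ and $1\le i\le N$ $$X_{n+1}^{i,N}=AX_n^{i,N}+\delta f(X_n^{i,N},\mu_n^N,\epsilon_{n+1}^i),\qquad \mu_n^N=\frac1N\sum_{i=1}^N\delta_{X_n^{i,N}}.$$ For $z\in\mathbb R^m$ let $$D(z)=\sup\frac{|f(x_1,\nu_1,z)-f(x_2,\nu_2,z)|}{|x_1-x_2|+\mathcal W_1(\nu_1,\nu_2)}\in[0,\infty],\qquad D_1(z)=|f(0,\delta_0,z)|,$$ the supremum being over $x_1\ne x_2$ in $\mathbb R^d$ and $\nu_1\neq\nu_2$ in $\mathcal P_1(\mathbb R^d)$; $D$ is assumed to be $\theta$-measurable. Assume that $\|A\|\le e^{-\omega}$ for some $\omega>0$, where $\|\cdot\|$ is the operator norm, and that for some $\alpha>0$ $$E|X_0^{i,N}|^{1+\alpha}<\infty,\qquad \int D(z)^{1+\alpha}\,\theta(dz)<\infty,\qquad \int D_1(z)^{1+\alpha}\,\theta(dz)<\infty .$$ Let $\sigma=\int D(z)\,\theta(dz)$ and $a_0=\frac{1-e^{-\omega}}{2\sigma}$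 ($a_0=\infty$ if $\sigma=0$), and suppose that $\delta\in(0,a_0)$. Then: 1. For every $\varepsilon>0$ there exist $N_0(\varepsilon),n_0(\varepsilon)\in\mathbb N$ such that $E\,\mathcal W_1(\mu_n^N,\mu_n)<\varepsilon$ whenever $n\ge n_0(\varepsilon)$ and $N\ge N_0(\varepsilon)$. 2. If $E\,\mathcal W_1(\mu_0^N,\mu_0)\to0$ as $N\to\infty$, then $\sup_{n\ge1}E\,\mathcal W_1(\mu_n^N,\mu_n)\to0$ as $N\to\infty$. -/

import Mathlib

open MeasureTheory ProbabilityTheory Filter Topology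
open scoped ENNReal

noncomputable section

/-- The Euclidean space `ℝ^d`. -/
abbrev Euc (d : ℕ) : Type := EuclideanSpace ℝ (Fin d)

/-- The Wasserstein-1 distance: the infimum of `E|X - Y|` over all couplings `π` of `μ` and `ν`. -/
def W1 {d : ℕ} (μ ν : ProbabilityMeasure (Euc d)) : ℝ≥0∞ :=
  ⨅ (π : Measure (Euc d × Euc d))
    (_ : π.map Prod.fst = (μ : Measure (Euc d)) ∧ π.map Prod.snd = (ν : Measure (Euc d))),
    ∫⁻ p, edist p.1 p.2 ∂π

/-- `μ` belongs to `P₁(ℝ^d)`: it has a finite first moment. -/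
def HasFirstMoment {d : ℕ} (μ : ProbabilityMeasure (Euc d)) : Prop :=
  ∫⁻ x, ‖x‖ₑ ∂(μ : Measure (Euc d)) < ∞

/-- The Dirac mass at a point. -/
def diracProb {d : ℕ} (x : Euc d) : ProbabilityMeasure (Euc d) :=
  ⟨Measure.dirac x, inferInstance⟩

/-- The empirical measure `(1/N) ∑ i, δ_{x i}` of `N ≥ 1` points. -/
def empirical {d : ℕ} {N : ℕ+} (x : Fin N → Euc d) : ProbabilityMeasure (Euc d) :=
  ⟨((N : ℕ) : ℝ≥0∞)⁻¹ • ∑ i, Measure.dirac (x i), ⟨by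
    simp [ENNReal.inv_mul_cancel]⟩⟩

/-- A finite family of random variables is exchangeable if its joint law is invariant under
permutations of the indices. -/
def IsExchangeable {Ω : Type*} [MeasurableSpace Ω] (P : Measure Ω) {d N : ℕ}
    (Y : Fin N → Ω → Euc d) : Prop :=
  ∀ π : Equiv.Perm (Fin N), P.map (fun ω i => Y (π i) ω) = P.map (fun ω i => Y i ω)

/-- The data of the dynamics `x ↦ A x + δ f(x, μ, z)`, with noise law `θ`. -/
structure MeanFieldModel (d m : ℕ) where
  A : Matrix (Fin d) (Fin d) ℝ
  δ : ℝ
  f : Euc d → ProbabilityMeasure (Euc d) → Euc m → Euc d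
  measurable_f :
    Measurable (fun p : Euc d × ProbabilityMeasure (Euc d) × Euc m => f p.1 p.2.1 p.2.2)
  θ : ProbabilityMeasure (Euc m)

namespace MeanFieldModel

variable {d m : ℕ} (M : MeanFieldModel d m)

/-- The operator on Euclidean space given by the matrix `A`; its norm is the operator norm
with respect to the Euclidean norm. -/
def opA : Euc d →L[ℝ] Euc d := Matrix.toEuclideanCLM (𝕜 := ℝ) M.A

/-- One step of the dynamics: `A x + δ f(x, μ, z)`. -/
def step (x : Euc d) (μ : ProbabilityMeasure (Euc d)) (z : Euc m) : Euc d :=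
  M.opA x + M.δ • M.f x μ z

theorem measurable_step (ρ : ProbabilityMeasure (Euc d)) :
    Measurable (fun p : Euc d × Euc m => M.step p.1 ρ p.2) := by
  have h : Measurable (fun p : Euc d × Euc m => M.f p.1 ρ p.2) :=
    M.measurable_f.comp
      (measurable_fst.prodMk (measurable_const.prodMk measurable_snd))
  exact (M.opA.continuous.measurable.comp measurable_fst).add (h.const_smul M.δ)

/-- The measure `μ P^ρ`: the law of `A X + δ f(X, ρ, ε)` when `(X, ε)` has law `μ ⊗ θ`. -/
def transport (μ ρ : ProbabilityMeasure (Euc d)) : ProbabilityMeasure (Euc d) :=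
  (μ.prod M.θ).map (f := fun p => M.step p.1 ρ p.2) (M.measurable_step ρ).aemeasurable

/-- The nonlinear evolution map `Ψ(μ) = μ P^μ`. -/
def Psi (μ : ProbabilityMeasure (Euc d)) : ProbabilityMeasure (Euc d) := M.transport μ μ

/-- The law `μ_n` of the nonlinear Markov chain started from `μ₀`: `μ_{n+1} = Ψ(μ_n)`. -/
def law (μ₀ : ProbabilityMeasure (Euc d)) : ℕ → ProbabilityMeasure (Euc d)
  | 0 => μ₀
  | n + 1 => M.Psi (law μ₀ n)

/-- The state at time `n` of the `N`-particle system with initial positions `x₀`; here `z n i` is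
the noise that drives particle `i` from time `n` to time `n + 1`. -/
def particles {N : ℕ+} (x₀ : Fin N → Euc d) (z : ℕ → Fin N → Euc m) : ℕ → Fin N → Euc d
  | 0 => x₀
  | n + 1 => fun i => M.step (particles x₀ z n i) (empirical (particles x₀ z n)) (z n i)

/-- The Lipschitz modulus `D(z)` of `f(·, ·, z)` on `ℝ^d × P₁(ℝ^d)`, with values in `[0, ∞]`. -/
def D (z : Euc m) : ℝ≥0∞ :=
  ⨆ (x₁ : Euc d) (x₂ : Euc d) (μ₁ : ProbabilityMeasure (Euc d)) (μ₂ : ProbabilityMeasure (Euc d))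
    (_ : x₁ ≠ x₂ ∧ μ₁ ≠ μ₂ ∧ HasFirstMoment μ₁ ∧ HasFirstMoment μ₂),
    edist (M.f x₁ μ₁ z) (M.f x₂ μ₂ z) / (edist x₁ x₂ + W1 μ₁ μ₂)

/-- `D₁(z) = |f(0, δ₀, z)|`. -/
def D₁ (z : Euc m) : ℝ≥0∞ := ‖M.f 0 (diracProb 0) z‖ₑ

/-- `σ = ∫ D dθ`. -/
def σ : ℝ≥0∞ := ∫⁻ z, M.D z ∂(M.θ : Measure (Euc m))

/-- `a₀ = (1 - e^{-ω}) / (2σ)`, which is `∞` when `σ = 0` and `ω > 0`. -/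
def a₀ (w : ℝ) : ℝ≥0∞ := ENNReal.ofReal (1 - Real.exp (-w)) / (2 * M.σ)

/-- The expectation `E W₁(μ_n^N, μ_n)`, where the `N`-particle system starts from the random
positions `X₀`, is driven by the noise `ξ`, and `μ_n` is the nonlinear law started from `μ₀`. -/
def expectedW1 {Ω : Type*} [MeasurableSpace Ω] (P : Measure Ω) (μ₀ : ProbabilityMeasure (Euc d))
    {N : ℕ+} (X₀ : Fin N → Ω → Euc d) (ξ : ℕ → Fin N → Ω → Euc m) (n : ℕ) : ℝ≥0∞ :=
  ∫⁻ ω, W1 (empirical (M.particles (fun i => X₀ i ω) (fun k i => ξ k i ω) n)) (M.law μ₀ n) ∂P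

end MeanFieldModel

end

section Wasserstein

variable {d : ℕ}

theorem W1_le_of_coupling {μ ν : ProbabilityMeasure (Euc d)} {π : Measure (Euc d × Euc d)}
    (h₁ : π.map Prod.fst = (μ : Measure (Euc d))) (h₂ : π.map Prod.snd = (ν : Measure (Euc d))) :
    W1 μ ν ≤ ∫⁻ p, edist p.1 p.2 ∂π :=
  iInf₂_le π ⟨h₁, h₂⟩

theorem isProbabilityMeasure_of_map_fst {α β : Type*} [MeasurableSpace α] [MeasurableSpace β]
    {π : Measure (α × β)} {μ : Measure α} [IsProbabilityMeasure μ] (h : π.map Prod.fst = μ) :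
    IsProbabilityMeasure π := by
  constructor
  rw [← Set.preimage_univ (f := Prod.fst), ← Measure.map_apply measurable_fst MeasurableSet.univ, h]
  exact measure_univ

/-- If `U` and `V`, defined on the same space, have laws `μ` and `ν`, then `W₁(μ, ν) ≤ E|U - V|`. -/
theorem W1_le_lintegral_edist {Ω : Type*} [MeasurableSpace Ω] {P : Measure Ω} {U V : Ω → Euc d}
    (hU : Measurable U) (hV : Measurable V) {μ ν : ProbabilityMeasure (Euc d)}
    (hμ : P.map U = (μ : Measure (Euc d))) (hν : P.map V = (ν : Measure (Euc d))) :
    W1 μ ν ≤ ∫⁻ ω, edist (U ω) (V ω) ∂P := by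
  have hUV := hU.prodMk hV
  refine (W1_le_of_coupling (π := P.map fun ω => (U ω, V ω)) ?_ ?_).trans_eq ?_
  · rw [Measure.map_map measurable_fst hUV]; exact hμ
  · rw [Measure.map_map measurable_snd hUV]; exact hν
  · rw [lintegral_map (measurable_fst.edist measurable_snd) hUV]

theorem W1_self (μ : ProbabilityMeasure (Euc d)) : W1 μ μ = 0 := by
  refine le_antisymm ?_ zero_le
  refine (W1_le_lintegral_edist (P := (μ : Measure (Euc d))) measurable_id measurable_id
    Measure.map_id Measure.map_id).trans_eq ?_
  simp

theorem W1_comm_le (μ ν : ProbabilityMeasure (Euc d)) : W1 μ ν ≤ W1 ν μ := by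
  refine le_iInf₂ fun π hπ => ?_
  refine (W1_le_lintegral_edist measurable_snd measurable_fst hπ.2 hπ.1).trans_eq ?_
  simp only [edist_comm]

theorem W1_comm (μ ν : ProbabilityMeasure (Euc d)) : W1 μ ν = W1 ν μ :=
  le_antisymm (W1_comm_le μ ν) (W1_comm_le ν μ)

/-- Gluing of two couplings along their common marginal. -/
theorem exists_gluing {α β γ : Type*} [MeasurableSpace α] [MeasurableSpace β] [MeasurableSpace γ]
    [StandardBorelSpace γ] [Nonempty γ] (π₁ : Measure (α × β)) (π₂ : Measure (β × γ))
    [IsProbabilityMeasure π₁] [IsProbabilityMeasure π₂]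
    (h : π₁.map Prod.snd = π₂.map Prod.fst) :
    ∃ γ' : Measure ((α × β) × γ), γ'.map Prod.fst = π₁ ∧
      γ'.map (fun q => (q.1.2, q.2)) = π₂ := by
  refine ⟨π₁ ⊗ₘ (π₂.condKernel.comap Prod.snd measurable_snd), ?_, ?_⟩
  · exact Measure.fst_compProd _ _
  · have hm : Measurable (fun q : (α × β) × γ => (q.1.2, q.2)) := by fun_prop
    ext s hs
    rw [Measure.map_apply hm hs, Measure.compProd_apply (hm hs)]
    have h2 : π₂ s = ∫⁻ y, π₂.condKernel y (Prod.mk y ⁻¹' s) ∂(π₁.map Prod.snd) := by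
      conv_lhs => rw [← π₂.disintegrate π₂.condKernel]
      rw [Measure.compProd_apply hs, h]; rfl
    rw [h2, lintegral_map (Kernel.measurable_kernel_prodMk_left hs) measurable_snd]
    rfl

theorem W1_triangle (μ ν ρ : ProbabilityMeasure (Euc d)) : W1 μ ρ ≤ W1 μ ν + W1 ν ρ := by
  conv_rhs => unfold W1
  refine ENNReal.le_iInf₂_add_iInf₂ fun π₁ h₁ π₂ h₂ => ?_
  have i₁ := isProbabilityMeasure_of_map_fst h₁.1
  have i₂ := isProbabilityMeasure_of_map_fst h₂.1
  obtain ⟨γ, hγ₁, hγ₂⟩ := exists_gluing π₁ π₂ (h₁.2.trans h₂.1.symm)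
  have hm : Measurable (fun q : (Euc d × Euc d) × Euc d => (q.1.2, q.2)) := by fun_prop
  have he : Measurable (fun p : Euc d × Euc d => edist p.1 p.2) :=
    measurable_fst.edist measurable_snd
  have hmu : γ.map (fun q => q.1.1) = (μ : Measure (Euc d)) := by
    rw [← h₁.1, ← hγ₁, Measure.map_map measurable_fst measurable_fst]; rfl
  have hrho : γ.map (fun q => q.2) = (ρ : Measure (Euc d)) := by
    rw [← h₂.2, ← hγ₂, Measure.map_map measurable_snd hm]; rfl
  refine (W1_le_lintegral_edist (by fun_prop) measurable_snd hmu hrho).trans ?_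
  calc ∫⁻ q, edist q.1.1 q.2 ∂γ ≤ ∫⁻ q, (edist q.1.1 q.1.2 + edist q.1.2 q.2) ∂γ :=
        lintegral_mono fun q => edist_triangle _ _ _
    _ = ∫⁻ q, edist q.1.1 q.1.2 ∂γ + ∫⁻ q, edist q.1.2 q.2 ∂γ :=
        lintegral_add_left (he.comp measurable_fst) _
    _ = _ := by
        conv_rhs => rw [← hγ₁, ← hγ₂, lintegral_map he measurable_fst, lintegral_map he hm]

/-- The first moment `‖μ‖₁`. -/
noncomputable def firstMoment (μ : ProbabilityMeasure (Euc d)) : ℝ≥0∞ :=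
  ∫⁻ x, ‖x‖ₑ ∂(μ : Measure (Euc d))

theorem W1_le_firstMoment_add (μ ν : ProbabilityMeasure (Euc d)) :
    W1 μ ν ≤ firstMoment μ + firstMoment ν := by
  refine (W1_le_lintegral_edist (P := (μ : Measure (Euc d)).prod (ν : Measure (Euc d)))
    measurable_fst measurable_snd (by simp) (by simp)).trans ?_
  calc _ ≤ ∫⁻ p, (‖p.1‖ₑ + ‖p.2‖ₑ) ∂((μ : Measure (Euc d)).prod (ν : Measure (Euc d))) := by
        refine lintegral_mono fun p => ?_
        rw [edist_eq_enorm_sub]; exact enorm_sub_le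
    _ = ∫⁻ p, ‖p.1‖ₑ ∂((μ : Measure (Euc d)).prod (ν : Measure (Euc d))) +
        ∫⁻ p, ‖p.2‖ₑ ∂((μ : Measure (Euc d)).prod (ν : Measure (Euc d))) :=
        lintegral_add_left (by fun_prop) _
    _ = _ := by
        rw [lintegral_prod _ (by fun_prop), lintegral_prod _ (by fun_prop)]
        simp [firstMoment]

theorem firstMoment_diracProb_zero : firstMoment (diracProb (0 : Euc d)) = 0 := by
  have h : Measurable (fun x : Euc d => ‖x‖ₑ) := by fun_prop
  simp [firstMoment, diracProb, lintegral_dirac' _ h]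

theorem lintegral_empirical {N : ℕ+} (x : Fin N → Euc d) {h : Euc d → ℝ≥0∞} (hh : Measurable h) :
    ∫⁻ y, h y ∂(empirical x : Measure (Euc d)) = ((N : ℕ) : ℝ≥0∞)⁻¹ * ∑ i, h (x i) := by
  simp [empirical, lintegral_smul_measure, lintegral_finsetSum_measure, lintegral_dirac' _ hh]

theorem empirical_apply {N : ℕ+} (x : Fin N → Euc d) {s : Set (Euc d)} (hs : MeasurableSet s) :
    (empirical x : Measure (Euc d)) s =
      ((N : ℕ) : ℝ≥0∞)⁻¹ * ∑ i, s.indicator (fun _ => 1) (x i) := by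
  rw [← lintegral_indicator_one hs, lintegral_empirical x (measurable_one.indicator hs)]
  rfl

theorem inv_natCast_mul_sum_const (N : ℕ+) (a : ℝ≥0∞) :
    ((N : ℕ) : ℝ≥0∞)⁻¹ * ∑ _i : Fin N, a = a := by
  rw [Finset.sum_const, Finset.card_univ, Fintype.card_fin, nsmul_eq_mul, ← mul_assoc,
    ENNReal.inv_mul_cancel (by simp) (by simp), one_mul]

theorem hasFirstMoment_empirical {N : ℕ+} (x : Fin N → Euc d) : HasFirstMoment (empirical x) := by
  rw [HasFirstMoment, lintegral_empirical x (by fun_prop)]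
  exact ENNReal.mul_lt_top (by simp) (ENNReal.sum_lt_top.2 fun i _ => enorm_lt_top)

theorem W1_empirical_le {N : ℕ+} (x y : Fin N → Euc d) :
    W1 (empirical x) (empirical y) ≤ ((N : ℕ) : ℝ≥0∞)⁻¹ * ∑ i, edist (x i) (y i) := by
  refine (W1_le_of_coupling
    (π := ((N : ℕ) : ℝ≥0∞)⁻¹ • ∑ i, Measure.dirac (x i, y i)) ?_ ?_).trans_eq ?_
  · simp only [empirical, ProbabilityMeasure.coe_mk, Measure.map_smul]
    rw [← Measure.mapₗ_apply_of_measurable measurable_fst, map_sum]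
    simp [Measure.mapₗ_apply_of_measurable measurable_fst, Measure.map_dirac]
  · simp only [empirical, ProbabilityMeasure.coe_mk, Measure.map_smul]
    rw [← Measure.mapₗ_apply_of_measurable measurable_snd, map_sum]
    simp [Measure.mapₗ_apply_of_measurable measurable_snd, Measure.map_dirac]
  · have he : Measurable (fun p : Euc d × Euc d => edist p.1 p.2) :=
      measurable_fst.edist measurable_snd
    simp [lintegral_smul_measure, lintegral_finsetSum_measure, lintegral_dirac' _ he]

theorem W1_empirical_le_edist {N : ℕ+} (x y : Fin N → Euc d) :
    W1 (empirical x) (empirical y) ≤ edist x y := by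
  refine (W1_empirical_le x y).trans ?_
  rw [← inv_natCast_mul_sum_const N (edist x y)]
  gcongr with i
  exact edist_le_pi_edist x y i

theorem measurable_empirical {N : ℕ+} :
    Measurable (fun x : Fin N → Euc d => empirical x) := by
  refine Measurable.subtype_mk (Measure.measurable_of_measurable_coe _ fun s hs => ?_)
  have : Measurable (fun x : Fin N → Euc d => ((N : ℕ) : ℝ≥0∞)⁻¹ *
      ∑ i, s.indicator (fun _ => (1 : ℝ≥0∞)) (x i)) := by
    refine (Finset.measurable_sum _ fun i _ => ?_).const_mul _
    exact (measurable_const.indicator hs).comp (measurable_pi_apply i)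
  convert this using 2 with x
  exact empirical_apply x hs

end Wasserstein

section Discretisation

variable {d : ℕ}

/-- Two laws that share the part `c` are coupled by keeping the common part on the diagonal. -/
theorem W1_le_of_common_part {μ ν : ProbabilityMeasure (Euc d)} {c a b : Measure (Euc d)}
    (hμ : (μ : Measure (Euc d)) = c + a) (hν : (ν : Measure (Euc d)) = c + b)
    (hab : a Set.univ = b Set.univ) :
    W1 μ ν ≤ ∫⁻ x, ‖x‖ₑ ∂a + ∫⁻ x, ‖x‖ₑ ∂b := by
  by_cases h0 : a Set.univ = 0
  · have ha : a = 0 := Measure.measure_univ_eq_zero.1 h0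
    have hb : b = 0 := Measure.measure_univ_eq_zero.1 (hab ▸ h0)
    have : μ = ν := Subtype.ext (by
      change (μ : Measure (Euc d)) = (ν : Measure (Euc d))
      rw [hμ, hν, ha, hb])
    rw [this, W1_self]
    exact zero_le
  have hat : a Set.univ ≠ ∞ := by
    have h1 : (μ : Measure (Euc d)) Set.univ = 1 := measure_univ
    rw [hμ, Measure.add_apply] at h1
    intro h
    simp [h] at h1
  have hbt : b Set.univ ≠ ∞ := hab ▸ hat
  have fa : IsFiniteMeasure a := ⟨hat.lt_top⟩
  have fb : IsFiniteMeasure b := ⟨hbt.lt_top⟩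
  have hd : Measurable (fun x : Euc d => (x, x)) := by fun_prop
  have he : Measurable (fun p : Euc d × Euc d => edist p.1 p.2) :=
    measurable_fst.edist measurable_snd
  refine (W1_le_of_coupling
    (π := c.map (fun x => (x, x)) + (a Set.univ)⁻¹ • a.prod b) ?_ ?_).trans ?_
  · rw [Measure.map_add _ _ measurable_fst, Measure.map_map measurable_fst hd, Measure.map_smul,
      Measure.map_fst_prod, hμ, ← hab, smul_smul, ENNReal.inv_mul_cancel h0 hat, one_smul]
    congr 1
    exact Measure.map_id
  · rw [Measure.map_add _ _ measurable_snd, Measure.map_map measurable_snd hd, Measure.map_smul,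
      Measure.map_snd_prod, hν, smul_smul, ENNReal.inv_mul_cancel h0 hat, one_smul]
    congr 1
    exact Measure.map_id
  · rw [lintegral_add_measure, lintegral_map he hd, lintegral_smul_measure]
    simp only [edist_self, lintegral_zero, zero_add]
    calc _ ≤ (a Set.univ)⁻¹ • ∫⁻ p, (‖p.1‖ₑ + ‖p.2‖ₑ) ∂(a.prod b) := by
          gcongr with p
          rw [edist_eq_enorm_sub]; exact enorm_sub_le
      _ = (a Set.univ)⁻¹ * (a Set.univ * (∫⁻ x, ‖x‖ₑ ∂a + ∫⁻ x, ‖x‖ₑ ∂b)) := by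
          rw [lintegral_add_left (by fun_prop), lintegral_prod _ (by fun_prop),
            lintegral_prod _ (by fun_prop)]
          simp only [lintegral_const, smul_eq_mul]
          rw [lintegral_mul_const _ (by fun_prop), ← hab]
          ring
      _ = _ := by rw [← mul_assoc, ENNReal.inv_mul_cancel h0 hat, one_mul]

theorem map_simpleFunc_eq_sum_dirac (μ : Measure (Euc d)) (T : SimpleFunc (Euc d) (Euc d)) :
    μ.map T = ∑ s ∈ T.range, μ (T ⁻¹' {s}) • Measure.dirac s := by
  refine Measure.ext_of_lintegral _ fun h hh => ?_
  rw [lintegral_map hh T.measurable, lintegral_finsetSum_measure]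
  simp only [lintegral_smul_measure, lintegral_dirac' _ hh, smul_eq_mul]
  rw [show (fun a => h (T a)) = T.map h from rfl, SimpleFunc.lintegral_eq_lintegral,
    SimpleFunc.map_lintegral]
  simp only [mul_comm]

theorem W1_map_simpleFunc_le (μ ν : ProbabilityMeasure (Euc d)) (T : SimpleFunc (Euc d) (Euc d))
    {C : ℝ≥0∞} (hC : ∀ x, ‖T x‖ₑ ≤ C) :
    W1 (μ.map T.measurable.aemeasurable) (ν.map T.measurable.aemeasurable) ≤
      2 * C * ∑ s ∈ T.range,
        ((μ : Measure (Euc d)) (T ⁻¹' {s}) - (ν : Measure (Euc d)) (T ⁻¹' {s})) := by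
  set u : Euc d → ℝ≥0∞ := fun s => (μ : Measure (Euc d)) (T ⁻¹' {s})
  set v : Euc d → ℝ≥0∞ := fun s => (ν : Measure (Euc d)) (T ⁻¹' {s})
  have hu : ∑ s ∈ T.range, u s = 1 := by
    rw [SimpleFunc.sum_range_measure_preimage_singleton]; exact measure_univ
  have hv : ∑ s ∈ T.range, v s = 1 := by
    rw [SimpleFunc.sum_range_measure_preimage_singleton]; exact measure_univ
  have hmass : ∑ s ∈ T.range, (u s - v s) = ∑ s ∈ T.range, (v s - u s) := by
    have h1 : ∑ s ∈ T.range, min (u s) (v s) + ∑ s ∈ T.range, (u s - v s) = 1 := by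
      rw [← Finset.sum_add_distrib, ← hu]
      refine Finset.sum_congr rfl fun s _ => ?_
      rw [add_comm, min_comm]
      rcases le_total (u s) (v s) with h | h
      · rw [min_eq_right h, tsub_eq_zero_of_le h, zero_add]
      · rw [min_eq_left h, tsub_add_cancel_of_le h]
    have h2 : ∑ s ∈ T.range, min (u s) (v s) + ∑ s ∈ T.range, (v s - u s) = 1 := by
      rw [← Finset.sum_add_distrib, ← hv]
      refine Finset.sum_congr rfl fun s _ => ?_
      rw [add_comm]
      rcases le_total (v s) (u s) with h | h
      · rw [min_eq_right h, tsub_eq_zero_of_le h, zero_add]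
      · rw [min_eq_left h, tsub_add_cancel_of_le h]
    have hfin : ∑ s ∈ T.range, min (u s) (v s) ≠ ∞ := by
      intro h; simp [h] at h1
    exact (ENNReal.add_right_inj hfin).1 (h1.trans h2.symm)
  have hmin : ∀ s, min (u s) (v s) + (u s - v s) = u s := fun s => by
    rcases le_total (u s) (v s) with h | h
    · rw [min_eq_left h, tsub_eq_zero_of_le h, add_zero]
    · rw [min_eq_right h, add_tsub_cancel_of_le h]
  have hmin' : ∀ s, min (u s) (v s) + (v s - u s) = v s := fun s => by
    rcases le_total (u s) (v s) with h | h
    · rw [min_eq_left h, add_tsub_cancel_of_le h]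
    · rw [min_eq_right h, tsub_eq_zero_of_le h, add_zero]
  have hnorm : Measurable (fun x : Euc d => ‖x‖ₑ) := by fun_prop
  have hbd : ∀ r : Euc d → ℝ≥0∞, ∫⁻ x, ‖x‖ₑ ∂(∑ s ∈ T.range, r s • Measure.dirac s) ≤
      C * ∑ s ∈ T.range, r s := fun r => by
    rw [lintegral_finsetSum_measure, Finset.mul_sum]
    refine Finset.sum_le_sum fun s hs => ?_
    obtain ⟨x, rfl⟩ := SimpleFunc.mem_range.1 hs
    rw [lintegral_smul_measure, lintegral_dirac' _ hnorm, smul_eq_mul, mul_comm]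
    gcongr
    exact hC x
  refine (W1_le_of_common_part (c := ∑ s ∈ T.range, min (u s) (v s) • Measure.dirac s)
    (a := ∑ s ∈ T.range, (u s - v s) • Measure.dirac s)
    (b := ∑ s ∈ T.range, (v s - u s) • Measure.dirac s) ?_ ?_ ?_).trans ?_
  · rw [ProbabilityMeasure.toMeasure_map, map_simpleFunc_eq_sum_dirac, ← Finset.sum_add_distrib]
    exact Finset.sum_congr rfl fun s _ => by rw [← add_smul, hmin]
  · rw [ProbabilityMeasure.toMeasure_map, map_simpleFunc_eq_sum_dirac, ← Finset.sum_add_distrib]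
    exact Finset.sum_congr rfl fun s _ => by rw [← add_smul, hmin']
  · simpa [Measure.finsetSum_apply] using hmass
  · refine (add_le_add (hbd _) (hbd _)).trans_eq ?_
    rw [← hmass]
    ring

/-- `|x|` outside of the ball of radius `R`, and `0` inside. -/
noncomputable def tailNorm (R : ℝ) (x : Euc d) : ℝ≥0∞ :=
  {x : Euc d | R < ‖x‖}.indicator (fun x => ‖x‖ₑ) x

theorem measurable_tailNorm (R : ℝ) : Measurable (tailNorm R : Euc d → ℝ≥0∞) :=
  Measurable.indicator (by fun_prop) (measurableSet_lt measurable_const measurable_norm)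

theorem exists_simpleFunc_edist_le (d : ℕ) (R : ℝ) {η : ℝ} (hη : 0 < η) :
    ∃ T : SimpleFunc (Euc d) (Euc d), ∀ x, edist x (T x) ≤ ENNReal.ofReal η + tailNorm R x := by
  set e : ℕ → Euc d := fun k => Nat.casesOn k 0 (TopologicalSpace.denseSeq (Euc d))
  have hcov : Metric.closedBall (0 : Euc d) R ⊆ ⋃ k : ℕ, Metric.ball (e k) η := by
    intro x _
    obtain ⟨y, ⟨k, rfl⟩, hk⟩ := Metric.mem_closure_iff.1
      (TopologicalSpace.denseRange_denseSeq (Euc d) x) η hη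
    exact Set.mem_iUnion.2 ⟨k + 1, hk⟩
  obtain ⟨t, ht⟩ := (isCompact_closedBall (0 : Euc d) R).elim_finite_subcover _
    (fun k => Metric.isOpen_ball) hcov
  refine ⟨SimpleFunc.nearestPt e (t.sup id), fun x => ?_⟩
  rw [edist_comm]
  by_cases hx : R < ‖x‖
  · refine (SimpleFunc.edist_nearestPt_le e x (Nat.zero_le _)).trans ?_
    rw [tailNorm, Set.indicator_of_mem (by exact hx)]
    simp [e, edist_comm (0 : Euc d)]
  · have hx' : x ∈ Metric.closedBall (0 : Euc d) R := by simpa using hx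
    obtain ⟨k, hk, hxk⟩ := Set.mem_iUnion₂.1 (ht hx')
    refine (SimpleFunc.edist_nearestPt_le e x (Finset.le_sup (f := id) hk)).trans ?_
    refine le_add_right ?_
    rw [edist_dist, dist_comm]
    exact ENNReal.ofReal_le_ofReal (Metric.mem_ball.1 hxk).le

theorem exists_simpleFunc_W1_le (d : ℕ) (R : ℝ) {η : ℝ} (hη : 0 < η) :
    ∃ (T : SimpleFunc (Euc d) (Euc d)) (C : ℝ≥0∞), C ≠ ∞ ∧ ∀ μ ν : ProbabilityMeasure (Euc d),
      W1 μ ν ≤ 2 * ENNReal.ofReal η + ∫⁻ x, tailNorm R x ∂(μ : Measure (Euc d)) +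
        ∫⁻ x, tailNorm R x ∂(ν : Measure (Euc d)) +
        C * ∑ s ∈ T.range,
          ((μ : Measure (Euc d)) (T ⁻¹' {s}) - (ν : Measure (Euc d)) (T ⁻¹' {s})) := by
  obtain ⟨T, hT⟩ := exists_simpleFunc_edist_le d R hη
  set C : ℝ≥0∞ := ∑ s ∈ T.range, ‖s‖ₑ
  have hC : ∀ x, ‖T x‖ₑ ≤ C := fun x =>
    Finset.single_le_sum (f := fun s : Euc d => ‖s‖ₑ) (fun _ _ => zero_le)
      (SimpleFunc.mem_range_self T x)
  have hmove : ∀ μ : ProbabilityMeasure (Euc d), W1 μ (μ.map T.measurable.aemeasurable) ≤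
      ENNReal.ofReal η + ∫⁻ x, tailNorm R x ∂(μ : Measure (Euc d)) := fun μ => by
    refine (W1_le_lintegral_edist (P := (μ : Measure (Euc d))) measurable_id T.measurable
      Measure.map_id (ProbabilityMeasure.toMeasure_map _ _).symm).trans ?_
    refine (lintegral_mono hT).trans_eq ?_
    rw [lintegral_add_left measurable_const]
    simp
  refine ⟨T, 2 * C, ENNReal.mul_ne_top (by simp)
    (ENNReal.sum_ne_top.2 fun s _ => enorm_ne_top), fun μ ν => ?_⟩
  calc W1 μ ν ≤ W1 μ (μ.map T.measurable.aemeasurable) +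
        (W1 (μ.map T.measurable.aemeasurable) (ν.map T.measurable.aemeasurable) +
          W1 (ν.map T.measurable.aemeasurable) ν) :=
        (W1_triangle _ _ _).trans (add_le_add le_rfl (W1_triangle _ _ _))
    _ ≤ (ENNReal.ofReal η + ∫⁻ x, tailNorm R x ∂(μ : Measure (Euc d))) +
        ((2 * C * ∑ s ∈ T.range,
          ((μ : Measure (Euc d)) (T ⁻¹' {s}) - (ν : Measure (Euc d)) (T ⁻¹' {s}))) +
          (ENNReal.ofReal η + ∫⁻ x, tailNorm R x ∂(ν : Measure (Euc d)))) := by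
        rw [W1_comm _ ν]
        exact add_le_add (hmove μ) (add_le_add (W1_map_simpleFunc_le μ ν T hC) (hmove ν))
    _ = _ := by ring

end Discretisation

section LawOfLargeNumbers

variable {d : ℕ} {E : Type*} [MeasurableSpace E]

/-- The mean of an integral against the empirical measure of samples with average law `ρ`. -/
theorem lintegral_pi_lintegral_empirical {N : ℕ+} (θ : Measure E) [IsProbabilityMeasure θ]
    {g : Fin N → E → Euc d} (hg : ∀ i, Measurable (g i)) {ρ : ProbabilityMeasure (Euc d)}
    (hρ : (ρ : Measure (Euc d)) = ((N : ℕ) : ℝ≥0∞)⁻¹ • ∑ i, θ.map (g i))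
    {h : Euc d → ℝ≥0∞} (hh : Measurable h) :
    ∫⁻ z, ∫⁻ x, h x ∂(empirical (fun i => g i (z i)) : Measure (Euc d))
      ∂(Measure.pi fun _ : Fin N => θ) = ∫⁻ x, h x ∂(ρ : Measure (Euc d)) := by
  have hi : ∀ i, Measurable fun z : Fin N → E => h (g i (z i)) := fun i =>
    hh.comp ((hg i).comp (measurable_pi_apply i))
  simp only [lintegral_empirical _ hh]
  rw [lintegral_const_mul _ (Finset.measurable_sum _ fun i _ => hi i),
    lintegral_finsetSum _ (fun i _ => hi i), hρ,
    lintegral_smul_measure, lintegral_finsetSum_measure, smul_eq_mul]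
  congr 1
  refine Finset.sum_congr rfl fun i _ => ?_
  rw [lintegral_map hh (hg i)]
  exact (measurePreserving_eval (fun _ : Fin N => θ) i).lintegral_comp (hh.comp (hg i))

/-- The empirical frequency of a set among independent samples is within `2 / √N` of its mean. -/
theorem lintegral_empirical_sub_le {N : ℕ+} (θ : Measure E) [IsProbabilityMeasure θ]
    {g : Fin N → E → Euc d} (hg : ∀ i, Measurable (g i)) {ρ : ProbabilityMeasure (Euc d)}
    (hρ : (ρ : Measure (Euc d)) = ((N : ℕ) : ℝ≥0∞)⁻¹ • ∑ i, θ.map (g i))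
    {B : Set (Euc d)} (hB : MeasurableSet B) :
    ∫⁻ z, ((empirical (fun i => g i (z i)) : Measure (Euc d)) B - (ρ : Measure (Euc d)) B)
      ∂(Measure.pi fun _ : Fin N => θ) ≤ ENNReal.ofReal (2 / √(N : ℕ)) := by
  set Q := Measure.pi fun _ : Fin N => θ
  have hN : (0 : ℝ) < (N : ℕ) := by exact_mod_cast N.pos
  have hsq : 0 < √((N : ℕ) : ℝ) := Real.sqrt_pos.2 hN
  set b : Euc d → ℝ := B.indicator (fun _ => 1)
  have hb : Measurable b := measurable_const.indicator hB
  have hb01 : ∀ x, b x ∈ Set.Icc (0 : ℝ) 1 := fun x => by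
    by_cases h : x ∈ B <;> simp [b, h]
  set Y : Fin N → (Fin N → E) → ℝ := fun i z => b (g i (z i))
  have hYm : ∀ i, Measurable (Y i) := fun i => hb.comp ((hg i).comp (measurable_pi_apply i))
  have hYp : ∀ i, MemLp (Y i) 2 Q := fun i =>
    MemLp.of_bound (hYm i).aestronglyMeasurable 1 (Eventually.of_forall fun z => by
      rw [Real.norm_eq_abs, abs_le]
      have := hb01 (g i (z i))
      exact ⟨by linarith [this.1], this.2⟩)
  have hYind : iIndepFun Y Q :=
    iIndepFun_pi (μ := fun _ : Fin N => θ) (X := fun i e => b (g i e))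
      fun i => (hb.comp (hg i)).aemeasurable
  set S : (Fin N → E) → ℝ := fun z => ((N : ℕ) : ℝ)⁻¹ * (∑ i, Y i) z
  have hSp : MemLp S 2 Q := (memLp_finsetSum' _ fun i _ => hYp i).const_mul _
  have hvar : Var[S; Q] ≤ ((N : ℕ) : ℝ)⁻¹ := by
    rw [variance_const_mul, IndepFun.variance_sum (fun i _ => hYp i)
      (fun i _ j _ hij => hYind.indepFun hij)]
    have : ∑ i, Var[Y i; Q] ≤ ∑ _i : Fin N, (1 : ℝ) := Finset.sum_le_sum fun i _ =>
      (variance_le_sq_of_bounded (a := 0) (b := 1)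
        (Eventually.of_forall fun z => hb01 _) (hYm i).aemeasurable).trans (by norm_num)
    simp only [Finset.sum_const, Finset.card_univ, Fintype.card_fin, nsmul_eq_mul, mul_one] at this
    calc _ ≤ (((N : ℕ) : ℝ)⁻¹) ^ 2 * ((N : ℕ) : ℝ) := by gcongr
      _ = _ := by field_simp
  have hYint : ∀ i, Q[Y i] = (θ.map (g i)).real B := fun i => by
    have hmp : Q.map (fun z => z i) = θ := (measurePreserving_eval (fun _ : Fin N => θ) i).map_eq
    have h1 : Q[Y i] = ∫ e, b (g i e) ∂(Q.map (fun z => z i)) :=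
      (integral_map (φ := fun z : Fin N → E => z i) (f := fun e => b (g i e))
        (measurable_pi_apply i).aemeasurable (hb.comp (hg i)).aestronglyMeasurable).symm
    rw [h1, hmp, ← integral_map (hg i).aemeasurable hb.aestronglyMeasurable, integral_indicator hB]
    simp
  have hmean : Q[S] = (ρ : Measure (Euc d)).real B := by
    simp only [S, Finset.sum_apply]
    rw [integral_const_mul, integral_finsetSum _ fun i _ => (hYp i).integrable (by norm_num)]
    simp only [hYint, hρ]
    simp only [Measure.real, Measure.smul_apply, Measure.finsetSum_apply, smul_eq_mul,
      ENNReal.toReal_mul, ENNReal.toReal_inv, ENNReal.toReal_natCast]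
    rw [ENNReal.toReal_sum]
    intro i _
    have := Measure.isProbabilityMeasure_map (μ := θ) (hg i).aemeasurable
    exact measure_ne_top _ _
  have hemp : ∀ z, (empirical (fun i => g i (z i)) : Measure (Euc d)).real B = S z := fun z => by
    rw [Measure.real, empirical_apply _ hB, ENNReal.toReal_mul, ENNReal.toReal_sum]
    · simp only [S, Finset.sum_apply, ENNReal.toReal_inv, ENNReal.toReal_natCast, Y, b]
      congr 1
      refine Finset.sum_congr rfl fun i _ => ?_
      by_cases h : g i (z i) ∈ B <;> simp [h]
    · intro i _
      by_cases h : g i (z i) ∈ B <;> simp [h]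
  have hpt : ∀ z, (empirical (fun i => g i (z i)) : Measure (Euc d)) B - (ρ : Measure (Euc d)) B ≤
      ENNReal.ofReal (1 / √(N : ℕ)) +
        ENNReal.ofReal (√(N : ℕ)) * ENNReal.ofReal ((S z - Q[S]) ^ 2) := fun z => by
    rw [← ofReal_measureReal, ← ofReal_measureReal, hemp, ← hmean,
      ← ENNReal.ofReal_sub _ (by rw [hmean]; exact measureReal_nonneg),
      ← ENNReal.ofReal_mul hsq.le, ← ENNReal.ofReal_add (by positivity) (by positivity)]
    refine ENNReal.ofReal_le_ofReal ?_
    set y := S z - Q[S]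
    set r := √((N : ℕ) : ℝ)
    rw [div_add' _ _ _ hsq.ne', le_div_iff₀ hsq]
    nlinarith [sq_nonneg (r * y - 1), sq_nonneg (r * y)]
  refine (lintegral_mono hpt).trans ?_
  rw [lintegral_add_left measurable_const, lintegral_const_mul' _ _ ENNReal.ofReal_ne_top,
    ← evariance_eq_lintegral_ofReal, ← ofReal_variance hSp, lintegral_const, measure_univ, mul_one,
    ← ENNReal.ofReal_mul hsq.le, ← ENNReal.ofReal_add (by positivity)
      (mul_nonneg hsq.le (variance_nonneg _ _))]
  refine ENNReal.ofReal_le_ofReal ?_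
  calc _ ≤ 1 / √((N : ℕ) : ℝ) + √((N : ℕ) : ℝ) * ((N : ℕ) : ℝ)⁻¹ := by gcongr
    _ = _ := by
        rw [← div_eq_mul_inv, Real.sqrt_div_self']
        ring

theorem tendsto_ofReal_two_div_sqrt :
    Tendsto (fun N : ℕ+ => ENNReal.ofReal (2 / √((N : ℕ) : ℝ))) atTop (𝓝 0) := by
  rw [← ENNReal.ofReal_zero]
  refine (ENNReal.continuous_ofReal.tendsto 0).comp ?_
  refine Tendsto.div_atTop tendsto_const_nhds (Real.tendsto_sqrt_atTop.comp ?_)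
  exact tendsto_natCast_atTop_atTop.comp tendsto_PNat_val_atTop_atTop

/-- A law of large numbers in `W₁` for independent samples that need not be identically
distributed; the rate depends on the sampled laws only through the tail of their average. -/
theorem exists_lintegral_W1_empirical_le (d : ℕ) (R : ℝ) {η : ℝ} (hη : 0 < η) :
    ∃ N₀ : ℕ+, ∀ N : ℕ+, N₀ ≤ N → ∀ {E : Type} [MeasurableSpace E] (θ : Measure E)
      [IsProbabilityMeasure θ] {g : Fin N → E → Euc d} (_ : ∀ i, Measurable (g i))
      {ρ : ProbabilityMeasure (Euc d)}
      (_ : (ρ : Measure (Euc d)) = ((N : ℕ) : ℝ≥0∞)⁻¹ • ∑ i, θ.map (g i)),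
      ∫⁻ z, W1 (empirical (fun i => g i (z i))) ρ ∂(Measure.pi fun _ : Fin N => θ) ≤
        ENNReal.ofReal η + 2 * ∫⁻ x, tailNorm R x ∂(ρ : Measure (Euc d)) := by
  obtain ⟨T, C, hC, hW⟩ := exists_simpleFunc_W1_le d R (η := η / 4) (by positivity)
  have hlim : Tendsto (fun N : ℕ+ => C * (T.range.card • ENNReal.ofReal (2 / √((N : ℕ) : ℝ))))
      atTop (𝓝 0) := by
    have h1 : Tendsto (fun N : ℕ+ => (C * T.range.card) * ENNReal.ofReal (2 / √((N : ℕ) : ℝ)))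
        atTop (𝓝 ((C * T.range.card) * 0)) :=
      ENNReal.Tendsto.const_mul tendsto_ofReal_two_div_sqrt
        (Or.inr (ENNReal.mul_ne_top hC (ENNReal.natCast_ne_top _)))
    simpa [mul_assoc] using h1
  obtain ⟨N₀, hN₀⟩ := eventually_atTop.1
    (hlim.eventually_le_const (ENNReal.ofReal_pos.2 (half_pos hη)))
  refine ⟨N₀, fun N hN E _ θ _ g hg ρ hρ => ?_⟩
  set Q := Measure.pi fun _ : Fin N => θ
  have hgz : Measurable fun z : Fin N → E => fun i => g i (z i) :=
    measurable_pi_lambda _ fun i => (hg i).comp (measurable_pi_apply i)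
  have hμ : Measurable fun z : Fin N → E => empirical fun i => g i (z i) :=
    measurable_empirical.comp hgz
  have hμB : ∀ B, MeasurableSet B →
      Measurable fun z : Fin N → E => (empirical fun i => g i (z i) : Measure (Euc d)) B :=
    fun B hB => (Measure.measurable_coe hB).comp (measurable_subtype_coe.comp hμ)
  have htail := lintegral_pi_lintegral_empirical θ hg hρ (measurable_tailNorm (d := d) R)
  have hfib : ∀ s, MeasurableSet (T ⁻¹' {s}) := fun s => T.measurableSet_fiber s
  have hsub : ∀ s, Measurable fun z : Fin N → E =>
      (empirical (fun i => g i (z i)) : Measure (Euc d)) (T ⁻¹' {s}) -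
        (ρ : Measure (Euc d)) (T ⁻¹' {s}) := fun s => (hμB _ (hfib s)).sub measurable_const
  calc _ ≤ ∫⁻ z, (2 * ENNReal.ofReal (η / 4) +
          ∫⁻ x, tailNorm R x ∂(empirical (fun i => g i (z i)) : Measure (Euc d)) +
          ∫⁻ x, tailNorm R x ∂(ρ : Measure (Euc d)) +
          C * ∑ s ∈ T.range, ((empirical (fun i => g i (z i)) : Measure (Euc d)) (T ⁻¹' {s}) -
            (ρ : Measure (Euc d)) (T ⁻¹' {s}))) ∂Q := lintegral_mono fun z => hW _ _
    _ = 2 * ENNReal.ofReal (η / 4) + ∫⁻ x, tailNorm R x ∂(ρ : Measure (Euc d)) +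
          ∫⁻ x, tailNorm R x ∂(ρ : Measure (Euc d)) +
          C * ∑ s ∈ T.range, ∫⁻ z, ((empirical (fun i => g i (z i)) : Measure (Euc d)) (T ⁻¹' {s}) -
            (ρ : Measure (Euc d)) (T ⁻¹' {s})) ∂Q := by
        rw [lintegral_add_right _ ((Finset.measurable_sum _ fun s _ => hsub s).const_mul _),
          lintegral_add_right _ measurable_const, lintegral_add_left measurable_const, htail,
          lintegral_const_mul _ (Finset.measurable_sum _ fun s _ => hsub s),
          lintegral_finsetSum _ (fun s _ => hsub s)]
        simp
    _ ≤ 2 * ENNReal.ofReal (η / 4) + ∫⁻ x, tailNorm R x ∂(ρ : Measure (Euc d)) +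
          ∫⁻ x, tailNorm R x ∂(ρ : Measure (Euc d)) +
          C * (T.range.card • ENNReal.ofReal (2 / √((N : ℕ) : ℝ))) := by
        gcongr
        exact Finset.sum_le_card_nsmul _ _ _ fun s _ => lintegral_empirical_sub_le θ hg hρ (hfib s)
    _ ≤ 2 * ENNReal.ofReal (η / 4) + ∫⁻ x, tailNorm R x ∂(ρ : Measure (Euc d)) +
          ∫⁻ x, tailNorm R x ∂(ρ : Measure (Euc d)) + ENNReal.ofReal (η / 2) := by
        gcongr
        exact hN₀ N hN
    _ = _ := by
        have h2 : 2 * ENNReal.ofReal (η / 4) = ENNReal.ofReal (η / 2) := by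
          rw [show η / 2 = 2 * (η / 4) by ring, ENNReal.ofReal_mul (by norm_num)]; simp
        have h3 : ENNReal.ofReal η = ENNReal.ofReal (η / 2) + ENNReal.ofReal (η / 2) := by
          rw [← ENNReal.ofReal_add (by positivity) (by positivity), add_halves]
        rw [h2, h3]
        ring

end LawOfLargeNumbers

section Perturbation

variable {d : ℕ}

theorem exists_enorm_le_ne_ne {F : Type*} [NormedAddCommGroup F] [NormedSpace ℝ F] [Nontrivial F]
    (a b : F) {η : ℝ} (hη : 0 < η) : ∃ v : F, ‖v‖ₑ ≤ ENNReal.ofReal η ∧ v ≠ a ∧ v ≠ b := by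
  have := Module.punctured_nhds_neBot ℝ F 0
  obtain ⟨v, hv, hv'⟩ := (infinite_of_mem_nhds (0 : F) (Metric.ball_mem_nhds 0 hη)).exists_notMem_finite
    (Set.toFinite {a, b})
  simp only [Set.mem_insert_iff, Set.mem_singleton_iff, not_or] at hv'
  refine ⟨v, ?_, hv'.1, hv'.2⟩
  rw [← ofReal_norm]
  exact ENNReal.ofReal_le_ofReal (by simpa using (Metric.mem_ball.1 hv).le)

theorem HasFirstMoment.integrable_id {μ : ProbabilityMeasure (Euc d)} (h : HasFirstMoment μ) :
    Integrable (fun x => x) (μ : Measure (Euc d)) :=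
  ⟨measurable_id.aestronglyMeasurable, h⟩

/-- A measure in `P₁` can be moved slightly so as to avoid itself and one further measure. -/
theorem exists_W1_le_ne_ne [Nontrivial (Euc d)] {μ : ProbabilityMeasure (Euc d)}
    (hμ : HasFirstMoment μ) (ν : ProbabilityMeasure (Euc d)) {η : ℝ} (hη : 0 < η) :
    ∃ ρ : ProbabilityMeasure (Euc d), HasFirstMoment ρ ∧ W1 μ ρ ≤ ENNReal.ofReal η ∧
      ρ ≠ μ ∧ ρ ≠ ν := by
  obtain ⟨v, hv, hv0, hvν⟩ := exists_enorm_le_ne_ne (0 : Euc d)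
    (∫ x, x ∂(ν : Measure (Euc d)) - ∫ x, x ∂(μ : Measure (Euc d))) hη
  have hm : Measurable fun x : Euc d => x + v := by fun_prop
  have hmean : ∫ x, x ∂(μ.map hm.aemeasurable : Measure (Euc d)) =
      ∫ x, x ∂(μ : Measure (Euc d)) + v := by
    rw [ProbabilityMeasure.toMeasure_map, integral_map (f := fun x => x)
      hm.aemeasurable measurable_id.aestronglyMeasurable, integral_add hμ.integrable_id (integrable_const _)]
    simp
  refine ⟨μ.map hm.aemeasurable, ?_, ?_, fun h => hv0 ?_, fun h => hvν ?_⟩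
  · rw [HasFirstMoment, ProbabilityMeasure.toMeasure_map, lintegral_map (by fun_prop) hm]
    calc _ ≤ ∫⁻ x, (‖x‖ₑ + ‖v‖ₑ) ∂(μ : Measure (Euc d)) := lintegral_mono fun x => enorm_add_le _ _
      _ = ∫⁻ x, ‖x‖ₑ ∂(μ : Measure (Euc d)) + ‖v‖ₑ := by
          rw [lintegral_add_right _ measurable_const]; simp
      _ < ∞ := ENNReal.add_lt_top.2 ⟨hμ, enorm_lt_top⟩
  · refine (W1_le_lintegral_edist (P := (μ : Measure (Euc d))) measurable_id hm
      Measure.map_id (ProbabilityMeasure.toMeasure_map _ _).symm).trans ?_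
    simpa [edist_eq_enorm_sub] using hv
  · rw [h] at hmean
    simpa using hmean
  · rw [h] at hmean
    rw [hmean, add_sub_cancel_left]

end Perturbation

namespace MeanFieldModel

variable {d m : ℕ} (M : MeanFieldModel d m)

theorem edist_f_le_of_ne {x₁ x₂ : Euc d} {ν₁ ν₂ : ProbabilityMeasure (Euc d)} (hx : x₁ ≠ x₂)
    (hν : ν₁ ≠ ν₂) (h₁ : HasFirstMoment ν₁) (h₂ : HasFirstMoment ν₂) (z : Euc m) :
    edist (M.f x₁ ν₁ z) (M.f x₂ ν₂ z) ≤ M.D z * (edist x₁ x₂ + W1 ν₁ ν₂) := by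
  have hD : edist (M.f x₁ ν₁ z) (M.f x₂ ν₂ z) / (edist x₁ x₂ + W1 ν₁ ν₂) ≤ M.D z :=
    le_iSup_of_le x₁ <| le_iSup_of_le x₂ <| le_iSup_of_le ν₁ <| le_iSup_of_le ν₂ <|
      le_iSup_of_le ⟨hx, hν, h₁, h₂⟩ le_rfl
  have hne : edist x₁ x₂ + W1 ν₁ ν₂ ≠ 0 := fun h => hx (edist_eq_zero.1 (add_eq_zero.1 h).1)
  have htop : edist x₁ x₂ + W1 ν₁ ν₂ ≠ ∞ := ENNReal.add_ne_top.2 ⟨edist_ne_top _ _,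
    ((W1_le_firstMoment_add ν₁ ν₂).trans_lt (ENNReal.add_lt_top.2 ⟨h₁, h₂⟩)).ne⟩
  exact (ENNReal.div_le_iff hne htop).1 hD

/-- The Lipschitz bound given by `D` also holds where the arguments of `f` coincide. -/
theorem edist_f_le {z : Euc m} (hz : M.D z ≠ ∞) (x₁ x₂ : Euc d)
    {ν₁ ν₂ : ProbabilityMeasure (Euc d)} (h₁ : HasFirstMoment ν₁) (h₂ : HasFirstMoment ν₂) :
    edist (M.f x₁ ν₁ z) (M.f x₂ ν₂ z) ≤ M.D z * (edist x₁ x₂ + W1 ν₁ ν₂) := by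
  rcases subsingleton_or_nontrivial (Euc d) with hd | hd
  · rw [Subsingleton.elim (M.f x₁ ν₁ z) (M.f x₂ ν₂ z), edist_self]
    exact zero_le
  have hlim : Tendsto (fun η : ℝ => M.D z * (edist x₁ x₂ + W1 ν₁ ν₂ + 4 * ENNReal.ofReal η))
      (𝓝[>] 0) (𝓝 (M.D z * (edist x₁ x₂ + W1 ν₁ ν₂ + 4 * ENNReal.ofReal 0))) := by
    refine ENNReal.Tendsto.const_mul (tendsto_const_nhds.add ?_) (Or.inr hz)
    exact ENNReal.Tendsto.const_mul (ENNReal.continuous_ofReal.continuousWithinAt)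
      (Or.inr (by simp))
  simp only [ENNReal.ofReal_zero, mul_zero, add_zero] at hlim
  refine ge_of_tendsto hlim (eventually_mem_nhdsWithin.mono fun η (hη : 0 < η) => ?_)
  obtain ⟨v, hv, hv0, hv2⟩ := exists_enorm_le_ne_ne (0 : Euc d) (x₂ - x₁) hη
  obtain ⟨ρ, hρ, hρη, hρ₁, hρ₂⟩ := exists_W1_le_ne_ne h₁ ν₂ hη
  have hx₁ : x₁ ≠ x₁ + v := fun h => hv0 (by simpa using h)
  have hx₂ : x₁ + v ≠ x₂ := fun h => hv2 (by rw [← h, add_sub_cancel_left])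
  have e₁ : edist x₁ (x₁ + v) ≤ ENNReal.ofReal η := by simpa [edist_eq_enorm_sub] using hv
  calc _ ≤ edist (M.f x₁ ν₁ z) (M.f (x₁ + v) ρ z) + edist (M.f (x₁ + v) ρ z) (M.f x₂ ν₂ z) :=
        edist_triangle _ _ _
    _ ≤ M.D z * (edist x₁ (x₁ + v) + W1 ν₁ ρ) + M.D z * (edist (x₁ + v) x₂ + W1 ρ ν₂) :=
        add_le_add (M.edist_f_le_of_ne hx₁ hρ₁.symm h₁ hρ z)
          (M.edist_f_le_of_ne hx₂ hρ₂ hρ h₂ z)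
    _ ≤ M.D z * (ENNReal.ofReal η + ENNReal.ofReal η) +
        M.D z * ((ENNReal.ofReal η + edist x₁ x₂) + (ENNReal.ofReal η + W1 ν₁ ν₂)) := by
        gcongr
        · refine (edist_triangle _ x₁ _).trans ?_
          rw [edist_comm]
          gcongr
        · refine (W1_triangle _ ν₁ _).trans ?_
          rw [W1_comm]
          gcongr
    _ = _ := by ring

theorem edist_step_le {z : Euc m} (hz : M.D z ≠ ∞) (x₁ x₂ : Euc d)
    {ν₁ ν₂ : ProbabilityMeasure (Euc d)} (h₁ : HasFirstMoment ν₁) (h₂ : HasFirstMoment ν₂) :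
    edist (M.step x₁ ν₁ z) (M.step x₂ ν₂ z) ≤
      ‖M.opA‖ₑ * edist x₁ x₂ + ‖M.δ‖ₑ * (M.D z * (edist x₁ x₂ + W1 ν₁ ν₂)) := by
  refine (edist_add_add_le _ _ _ _).trans (add_le_add ?_ ?_)
  · rw [edist_eq_enorm_sub, ← map_sub, edist_eq_enorm_sub]
    exact M.opA.le_opENorm _
  · rw [edist_smul₀, ENNReal.smul_def, smul_eq_mul, ← enorm_eq_nnnorm]
    gcongr
    exact M.edist_f_le hz _ _ h₁ h₂

theorem enorm_step_le {z : Euc m} (hz : M.D z ≠ ∞) (x : Euc d)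
    {ν : ProbabilityMeasure (Euc d)} (h : HasFirstMoment ν) :
    ‖M.step x ν z‖ₑ ≤
      ‖M.opA‖ₑ * ‖x‖ₑ + ‖M.δ‖ₑ * (M.D z * (‖x‖ₑ + firstMoment ν) + M.D₁ z) := by
  have h0 : HasFirstMoment (diracProb (0 : Euc d)) := by
    change firstMoment (diracProb (0 : Euc d)) < ∞
    rw [firstMoment_diracProb_zero]; simp
  have hf : ‖M.f x ν z‖ₑ ≤ M.D z * (‖x‖ₑ + firstMoment ν) + M.D₁ z := by
    calc ‖M.f x ν z‖ₑ = ‖(M.f x ν z - M.f 0 (diracProb 0) z) + M.f 0 (diracProb 0) z‖ₑ := by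
          rw [sub_add_cancel]
      _ ≤ edist (M.f x ν z) (M.f 0 (diracProb 0) z) + M.D₁ z := by
          rw [edist_eq_enorm_sub]; exact enorm_add_le _ _
      _ ≤ M.D z * (edist x 0 + W1 ν (diracProb 0)) + M.D₁ z := by
          gcongr; exact M.edist_f_le hz _ _ h h0
      _ ≤ _ := by
          rw [edist_zero_right]
          gcongr
          refine (W1_le_firstMoment_add _ _).trans ?_
          rw [firstMoment_diracProb_zero, add_zero]
  refine (enorm_add_le _ _).trans (add_le_add (M.opA.le_opENorm _) ?_)
  rw [enorm_smul]
  gcongr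

/-- The Lipschitz constant of the nonlinear evolution map with respect to `W₁`. -/
noncomputable def rate : ℝ≥0∞ := ‖M.opA‖ₑ + 2 * ‖M.δ‖ₑ * M.σ

theorem rate_ne_top (hσ : M.σ ≠ ∞) : M.rate ≠ ∞ :=
  ENNReal.add_ne_top.2 ⟨enorm_ne_top,
    ENNReal.mul_ne_top (ENNReal.mul_ne_top (by simp) enorm_ne_top) hσ⟩

theorem measurable_D₁ : Measurable M.D₁ := by
  have h : Measurable (fun z : Euc m => M.f 0 (diracProb 0) z) :=
    M.measurable_f.comp (measurable_const.prodMk (measurable_const.prodMk measurable_id))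
  exact h.enorm

theorem ae_D_ne_top (hD : AEMeasurable M.D (M.θ : Measure (Euc m))) (hσ : M.σ ≠ ∞) :
    ∀ᵐ z ∂(M.θ : Measure (Euc m)), M.D z ≠ ∞ :=
  (ae_lt_top' hD hσ).mono fun _ h => h.ne

theorem measurable_step_comp {Ω : Type*} [MeasurableSpace Ω] (ρ : ProbabilityMeasure (Euc d))
    {U : Ω → Euc d} (hU : Measurable U) :
    Measurable fun q : Ω × Euc m => M.step (U q.1) ρ q.2 := by
  have h : Measurable fun q : Ω × Euc m => (U q.1, q.2) := by fun_prop
  have hs := (M.measurable_step ρ).comp h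
  exact hs

theorem map_step_prod {Ω : Type*} [MeasurableSpace Ω] {P : Measure Ω} [IsProbabilityMeasure P]
    {μ : ProbabilityMeasure (Euc d)} (ρ : ProbabilityMeasure (Euc d)) {U : Ω → Euc d}
    (hU : Measurable U) (hμ : P.map U = (μ : Measure (Euc d))) :
    (P.prod (M.θ : Measure (Euc m))).map (fun q => M.step (U q.1) ρ q.2) =
      (M.transport μ ρ : Measure (Euc d)) := by
  rw [transport, ProbabilityMeasure.toMeasure_map, ProbabilityMeasure.toMeasure_prod, ← hμ]
  have h : (P.map U).prod (M.θ : Measure (Euc m)) =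
      (P.prod (M.θ : Measure (Euc m))).map (Prod.map U id) := by
    rw [← Measure.map_prod_map _ _ hU measurable_id, Measure.map_id]
  rw [h, Measure.map_map (M.measurable_step ρ) (hU.prodMap measurable_id)]
  rfl

theorem W1_Psi_le (hD : AEMeasurable M.D (M.θ : Measure (Euc m))) (hσ : M.σ ≠ ∞)
    {μ ν : ProbabilityMeasure (Euc d)} (hμ : HasFirstMoment μ) (hν : HasFirstMoment ν) :
    W1 (M.Psi μ) (M.Psi ν) ≤ M.rate * W1 μ ν := by
  have hW : W1 μ ν ≠ ∞ :=
    ((W1_le_firstMoment_add μ ν).trans_lt (ENNReal.add_lt_top.2 ⟨hμ, hν⟩)).ne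
  have hrate : M.rate ≠ ∞ := M.rate_ne_top hσ
  rw [mul_comm, ← ENNReal.div_le_iff_le_mul (Or.inr hW) (Or.inl hrate)]
  refine le_iInf₂ fun π hπ => ENNReal.div_le_of_le_mul' ?_
  have hIW : W1 μ ν ≤ ∫⁻ p, edist p.1 p.2 ∂π := W1_le_of_coupling hπ.1 hπ.2
  have iπ := isProbabilityMeasure_of_map_fst hπ.1
  set Q : Measure ((Euc d × Euc d) × Euc m) := π.prod (M.θ : Measure (Euc m))
  have hU := M.measurable_step_comp μ (measurable_fst (α := Euc d) (β := Euc d))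
  have hV := M.measurable_step_comp ν (measurable_snd (α := Euc d) (β := Euc d))
  have hUl : Q.map _ = _ := M.map_step_prod μ measurable_fst hπ.1
  have hVl : Q.map _ = _ := M.map_step_prod ν measurable_snd hπ.2
  refine (W1_le_lintegral_edist hU hV hUl hVl).trans ?_
  have hae : ∀ᵐ q ∂Q, M.D q.2 ≠ ∞ :=
    Measure.quasiMeasurePreserving_snd.ae (M.ae_D_ne_top hD hσ)
  have he : Measurable (fun p : Euc d × Euc d => edist p.1 p.2) :=
    measurable_fst.edist measurable_snd
  have he' : Measurable (fun q : (Euc d × Euc d) × Euc m => edist q.1.1 q.1.2) :=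
    he.comp measurable_fst
  set I := ∫⁻ p, edist p.1 p.2 ∂π
  calc _ ≤ ∫⁻ q, (‖M.opA‖ₑ * edist q.1.1 q.1.2 +
        ‖M.δ‖ₑ * (M.D q.2 * (edist q.1.1 q.1.2 + W1 μ ν))) ∂Q :=
        lintegral_mono_ae (hae.mono fun q hq => M.edist_step_le hq _ _ hμ hν)
    _ = ‖M.opA‖ₑ * ∫⁻ q, edist q.1.1 q.1.2 ∂Q +
        ‖M.δ‖ₑ * ∫⁻ q, (edist q.1.1 q.1.2 + W1 μ ν) * M.D q.2 ∂Q := by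
        rw [lintegral_add_left (he'.const_mul _),
          lintegral_const_mul' _ _ enorm_ne_top, lintegral_const_mul' _ _ enorm_ne_top]
        simp only [mul_comm]
    _ = ‖M.opA‖ₑ * I + ‖M.δ‖ₑ * ((I + W1 μ ν) * M.σ) := by
        congr 2
        · rw [lintegral_prod _ he'.aemeasurable]
          simp [I]
        · rw [lintegral_prod_mul (f := fun p : Euc d × Euc d => edist p.1 p.2 + W1 μ ν)
            (he.add measurable_const).aemeasurable hD, lintegral_add_left he]
          simp [I, σ]
    _ ≤ ‖M.opA‖ₑ * I + ‖M.δ‖ₑ * ((I + I) * M.σ) := by gcongr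
    _ = _ := by rw [rate]; ring

theorem hasFirstMoment_Psi (hD : AEMeasurable M.D (M.θ : Measure (Euc m))) (hσ : M.σ ≠ ∞)
    (hD₁ : ∫⁻ z, M.D₁ z ∂(M.θ : Measure (Euc m)) ≠ ∞) {μ : ProbabilityMeasure (Euc d)}
    (hμ : HasFirstMoment μ) : HasFirstMoment (M.Psi μ) := by
  rw [HasFirstMoment, Psi, transport, ProbabilityMeasure.toMeasure_map,
    ProbabilityMeasure.toMeasure_prod, lintegral_map (by fun_prop) (M.measurable_step μ)]
  set Q := (μ : Measure (Euc d)).prod (M.θ : Measure (Euc m))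
  have hae : ∀ᵐ q ∂Q, M.D q.2 ≠ ∞ :=
    Measure.quasiMeasurePreserving_snd.ae (M.ae_D_ne_top hD hσ)
  have hD₁m : Measurable fun q : Euc d × Euc m => M.D₁ q.2 := M.measurable_D₁.comp measurable_snd
  calc _ ≤ ∫⁻ q, (‖M.opA‖ₑ * ‖q.1‖ₑ +
        ‖M.δ‖ₑ * ((‖q.1‖ₑ + firstMoment μ) * M.D q.2 + M.D₁ q.2)) ∂Q :=
        lintegral_mono_ae (hae.mono fun q hq => by
          have := M.enorm_step_le hq q.1 hμ
          rwa [mul_comm (M.D q.2)] at this)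
    _ = ‖M.opA‖ₑ * firstMoment μ + ‖M.δ‖ₑ * ((firstMoment μ + firstMoment μ) * M.σ +
        ∫⁻ z, M.D₁ z ∂(M.θ : Measure (Euc m))) := by
        rw [lintegral_add_left (by fun_prop), lintegral_const_mul' _ _ enorm_ne_top,
          lintegral_const_mul' _ _ enorm_ne_top,
          lintegral_add_right _ hD₁m]
        congr 2
        · rw [lintegral_prod _ (by fun_prop)]
          simp [firstMoment]
        · congr 1
          · rw [lintegral_prod_mul (f := fun x : Euc d => ‖x‖ₑ + firstMoment μ)
              (by fun_prop) hD, lintegral_add_left (by fun_prop)]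
            simp [firstMoment, σ]
          · rw [lintegral_prod _ hD₁m.aemeasurable]
            simp
    _ < ∞ := by
        have hμ' : firstMoment μ ≠ ∞ := (show firstMoment μ < ∞ from hμ).ne
        refine (ENNReal.add_ne_top.2 ⟨ENNReal.mul_ne_top enorm_ne_top hμ',
          ENNReal.mul_ne_top enorm_ne_top (ENNReal.add_ne_top.2
            ⟨ENNReal.mul_ne_top (ENNReal.add_ne_top.2 ⟨hμ', hμ'⟩) hσ, hD₁⟩)⟩).lt_top

theorem hasFirstMoment_law (hD : AEMeasurable M.D (M.θ : Measure (Euc m))) (hσ : M.σ ≠ ∞)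
    (hD₁ : ∫⁻ z, M.D₁ z ∂(M.θ : Measure (Euc m)) ≠ ∞) {μ₀ : ProbabilityMeasure (Euc d)}
    (hμ₀ : HasFirstMoment μ₀) (n : ℕ) : HasFirstMoment (M.law μ₀ n) := by
  induction n with
  | zero => exact hμ₀
  | succ n ih => exact M.hasFirstMoment_Psi hD hσ hD₁ ih

end MeanFieldModel

section Independence

theorem indepFun_prodMk_left {Ω α β γ : Type*} [MeasurableSpace Ω] [MeasurableSpace α]
    [MeasurableSpace β] [MeasurableSpace γ] {P : Measure Ω} [IsProbabilityMeasure P]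
    {A : Ω → α} {B : Ω → β} {C : Ω → γ} (hA : Measurable A) (hB : Measurable B) (hC : Measurable C)
    (hABC : IndepFun A (fun ω => (B ω, C ω)) P) (hBC : IndepFun B C P) :
    IndepFun (fun ω => (A ω, B ω)) C P := by
  have iA := Measure.isProbabilityMeasure_map (μ := P) hA.aemeasurable
  have iB := Measure.isProbabilityMeasure_map (μ := P) hB.aemeasurable
  have iC := Measure.isProbabilityMeasure_map (μ := P) hC.aemeasurable
  have hAB : IndepFun A B P := hABC.comp measurable_id measurable_fst
  have h1 := hABC.map_prod_eq_prod_map_map hA.aemeasurable (hB.prodMk hC).aemeasurable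
  rw [hBC.map_prod_eq_prod_map_map hB.aemeasurable hC.aemeasurable] at h1
  rw [indepFun_iff_map_prod_eq_prod_map_map (hA.prodMk hB).aemeasurable hC.aemeasurable,
    hAB.map_prod_eq_prod_map_map hA.aemeasurable hB.aemeasurable]
  have h2 : P.map (fun ω => ((A ω, B ω), C ω)) =
      (P.map (fun ω => (A ω, (B ω, C ω)))).map MeasurableEquiv.prodAssoc.symm := by
    rw [Measure.map_map (by fun_prop) (by fun_prop)]
    rfl
  rw [h2, h1, ← Measure.prodAssoc_prod, Measure.map_map (by fun_prop) (by fun_prop)]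
  simp

end Independence

namespace MeanFieldModel

variable {d m : ℕ} (M : MeanFieldModel d m) {N : ℕ+}

/-- One step of the `N`-particle system. -/
noncomputable def stepAll (x : Fin N → Euc d) (z : Fin N → Euc m) : Fin N → Euc d :=
  fun i => M.step (x i) (empirical x) (z i)

theorem measurable_stepAll :
    Measurable fun p : (Fin N → Euc d) × (Fin N → Euc m) => M.stepAll p.1 p.2 := by
  refine measurable_pi_lambda _ fun i => ?_
  have h1 : Measurable fun p : (Fin N → Euc d) × (Fin N → Euc m) => p.1 i := by fun_prop
  have h2 : Measurable fun p : (Fin N → Euc d) × (Fin N → Euc m) => p.2 i := by fun_prop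
  have h3 : Measurable fun p : (Fin N → Euc d) × (Fin N → Euc m) => empirical p.1 :=
    measurable_empirical.comp measurable_fst
  have hf := M.measurable_f.comp (h1.prodMk (h3.prodMk h2))
  have hA := M.opA.continuous.measurable.comp h1
  exact hA.add (hf.const_smul M.δ)

theorem measurable_particles (n : ℕ) :
    Measurable fun q : (Fin N → Euc d) × (ℕ → Fin N → Euc m) => M.particles q.1 q.2 n := by
  induction n with
  | zero => exact measurable_fst
  | succ n ih =>
    have hz : Measurable fun q : (Fin N → Euc d) × (ℕ → Fin N → Euc m) => q.2 n := by fun_prop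
    have h := M.measurable_stepAll.comp (ih.prodMk hz)
    exact h

theorem particles_congr (x₀ : Fin N → Euc d) {z z' : ℕ → Fin N → Euc m} {n : ℕ}
    (h : ∀ k < n, z k = z' k) : M.particles x₀ z n = M.particles x₀ z' n := by
  induction n with
  | zero => rfl
  | succ n ih =>
    funext i
    simp only [particles]
    rw [ih fun k hk => h k (hk.trans n.lt_succ_self), h n n.lt_succ_self]

variable {Ω : Type*} {X₀ : Fin N → Ω → Euc d} {ξ : ℕ → Fin N → Ω → Euc m}

/-- The random state at time `n` of the particle system. -/
noncomputable def state (X₀ : Fin N → Ω → Euc d) (ξ : ℕ → Fin N → Ω → Euc m) (n : ℕ) (ω : Ω) :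
    Fin N → Euc d :=
  M.particles (fun i => X₀ i ω) (fun k i => ξ k i ω) n

variable [MeasurableSpace Ω] {P : Measure Ω} [IsProbabilityMeasure P]

theorem measurable_state (hX₀ : ∀ i, Measurable (X₀ i)) (hξ : ∀ k i, Measurable (ξ k i)) (n : ℕ) :
    Measurable (M.state X₀ ξ n) := by
  have h1 : Measurable fun ω => ((fun i => X₀ i ω), (fun k i => ξ k i ω)) := by fun_prop
  have h := (M.measurable_particles n).comp h1
  exact h

theorem indepFun_state (hX₀ : ∀ i, Measurable (X₀ i)) (hξ : ∀ k i, Measurable (ξ k i))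
    (hind : iIndepFun (fun p : ℕ × Fin N => ξ p.1 p.2) P)
    (hind₀ : IndepFun (fun ω i => X₀ i ω) (fun ω (p : ℕ × Fin N) => ξ p.1 p.2 ω) P) (n : ℕ) :
    IndepFun (M.state X₀ ξ n) (fun ω i => ξ n i ω) P := by
  classical
  set S : Finset (ℕ × Fin N) := Finset.range n ×ˢ Finset.univ
  set T : Finset (ℕ × Fin N) := {n} ×ˢ Finset.univ
  have hST : Disjoint S T := by
    refine Finset.disjoint_left.2 fun p hp hp' => ?_
    simp only [S, T, Finset.mem_product, Finset.mem_range, Finset.mem_singleton] at hp hp'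
    omega
  have hT : ∀ i, (n, i) ∈ T := fun i => by simp [T]
  set B : Ω → S → Euc m := fun ω p => ξ p.1.1 p.1.2 ω
  have hB : Measurable B := measurable_pi_lambda _ fun p => hξ _ _
  have hC : Measurable fun ω i => ξ n i ω := measurable_pi_lambda _ fun i => hξ _ _
  have hA : Measurable fun ω i => X₀ i ω := measurable_pi_lambda _ fun i => hX₀ _
  have hBC : IndepFun B (fun ω i => ξ n i ω) P :=
    (hind.indepFun_finset S T hST fun p => hξ _ _).comp measurable_id
      (ψ := fun (b : T → Euc m) i => b ⟨(n, i), hT i⟩) (by fun_prop)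
  have hABC : IndepFun (fun ω i => X₀ i ω) (fun ω => (B ω, fun i => ξ n i ω)) P :=
    hind₀.comp measurable_id
      (ψ := fun z : ℕ × Fin N → Euc m => ((fun p : S => z p.1), (fun i => z (n, i))))
      (by fun_prop)
  have hABC' := indepFun_prodMk_left hA hB hC hABC hBC
  set ext : (S → Euc m) → ℕ → Fin N → Euc m := fun b k i =>
    if h : (k, i) ∈ S then b ⟨(k, i), h⟩ else 0
  have hext : Measurable ext := by
    refine measurable_pi_lambda _ fun k => measurable_pi_lambda _ fun i => ?_
    by_cases h : (k, i) ∈ S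
    · simp only [ext, h, dite_true]; fun_prop
    · simp only [ext, h, dite_false]; fun_prop
  have hΦ : Measurable fun q : (Fin N → Euc d) × (S → Euc m) => M.particles q.1 (ext q.2) n := by
    have h1 : Measurable fun q : (Fin N → Euc d) × (S → Euc m) => (q.1, ext q.2) := by fun_prop
    have h := (M.measurable_particles n).comp h1
    exact h
  have hres := hABC'.comp hΦ measurable_id
  have heq : M.state X₀ ξ n =
      (fun q : (Fin N → Euc d) × (S → Euc m) => M.particles q.1 (ext q.2) n) ∘
        (fun ω => ((fun i => X₀ i ω), B ω)) := by
    funext ω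
    refine M.particles_congr _ fun k hk => ?_
    funext i
    have h : (k, i) ∈ S := by simp [S, hk]
    simp [ext, h, B]
  rw [heq]
  exact hres

theorem map_noise (hξ : ∀ k i, Measurable (ξ k i))
    (hlaw : ∀ k i, P.map (ξ k i) = (M.θ : Measure (Euc m)))
    (hind : iIndepFun (fun p : ℕ × Fin N => ξ p.1 p.2) P) (n : ℕ) :
    P.map (fun ω i => ξ n i ω) = Measure.pi fun _ : Fin N => (M.θ : Measure (Euc m)) := by
  have h : iIndepFun (fun i : Fin N => ξ n i) P :=
    hind.precomp (g := fun i : Fin N => (n, i)) fun i j hij => by simpa using hij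
  rw [(iIndepFun_iff_map_fun_eq_pi_map fun i => (hξ n i).aemeasurable).1 h]
  simp only [hlaw]

/-- The expectation at time `n` may be computed by first averaging over the fresh noise. -/
theorem lintegral_state_noise (hX₀ : ∀ i, Measurable (X₀ i)) (hξ : ∀ k i, Measurable (ξ k i))
    (hlaw : ∀ k i, P.map (ξ k i) = (M.θ : Measure (Euc m)))
    (hind : iIndepFun (fun p : ℕ × Fin N => ξ p.1 p.2) P)
    (hind₀ : IndepFun (fun ω i => X₀ i ω) (fun ω (p : ℕ × Fin N) => ξ p.1 p.2 ω) P) (n : ℕ)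
    {F : (Fin N → Euc d) × (Fin N → Euc m) → ℝ≥0∞} (hF : Measurable F) :
    ∫⁻ ω, F (M.state X₀ ξ n ω, fun i => ξ n i ω) ∂P =
      ∫⁻ ω, ∫⁻ z, F (M.state X₀ ξ n ω, z)
        ∂(Measure.pi fun _ : Fin N => (M.θ : Measure (Euc m))) ∂P := by
  have hS := M.measurable_state hX₀ hξ n
  have hC : Measurable fun ω i => ξ n i ω := measurable_pi_lambda _ fun i => hξ _ _
  have h := (M.indepFun_state hX₀ hξ hind hind₀ n).map_prod_eq_prod_map_map hS.aemeasurable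
    hC.aemeasurable
  rw [M.map_noise hξ hlaw hind n] at h
  rw [← lintegral_map hF (hS.prodMk hC), h, lintegral_prod _ hF.aemeasurable,
    lintegral_map hF.lintegral_prod_right' hS]

end MeanFieldModel

section LpMean

variable {Ω : Type*} [MeasurableSpace Ω]

/-- The `L^p` norm of a function with values in `[0, ∞]`. -/
noncomputable def lpMean (p : ℝ) (P : Measure Ω) (F : Ω → ℝ≥0∞) : ℝ≥0∞ :=
  (∫⁻ ω, F ω ^ p ∂P) ^ (1 / p)

theorem lpMean_le_iff {p : ℝ} (hp : 0 < p) {P : Measure Ω} {F : Ω → ℝ≥0∞} {B : ℝ≥0∞} :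
    lpMean p P F ≤ B ↔ ∫⁻ ω, F ω ^ p ∂P ≤ B ^ p := by
  rw [lpMean, one_div, ENNReal.rpow_inv_le_iff hp]

theorem lpMean_mono_ae {p : ℝ} (hp : 0 ≤ p) {P : Measure Ω} {F G : Ω → ℝ≥0∞}
    (h : ∀ᵐ ω ∂P, F ω ≤ G ω) : lpMean p P F ≤ lpMean p P G :=
  ENNReal.rpow_le_rpow (lintegral_mono_ae (h.mono fun _ hω => ENNReal.rpow_le_rpow hω hp))
    (by positivity)

theorem lpMean_add_le {p : ℝ} (hp : 1 ≤ p) {P : Measure Ω} {F G : Ω → ℝ≥0∞} (hF : AEMeasurable F P)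
    (hG : AEMeasurable G P) :
    lpMean p P (fun ω => F ω + G ω) ≤ lpMean p P F + lpMean p P G :=
  ENNReal.lintegral_Lp_add_le hF hG hp

theorem lpMean_const_mul {p : ℝ} (hp : 0 < p) {P : Measure Ω} {c : ℝ≥0∞} (hc : c ≠ ∞)
    (F : Ω → ℝ≥0∞) : lpMean p P (fun ω => c * F ω) = c * lpMean p P F := by
  simp only [lpMean, ENNReal.mul_rpow_of_nonneg _ _ hp.le]
  rw [lintegral_const_mul' _ _ (ENNReal.rpow_ne_top_of_nonneg hp.le hc),
    ENNReal.mul_rpow_of_nonneg _ _ (by positivity), one_div, ENNReal.rpow_rpow_inv hp.ne']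

theorem lpMean_mul_of_indepFun {p : ℝ} (hp : 0 < p) {P : Measure Ω} {F G : Ω → ℝ≥0∞}
    (hF : Measurable F) (hG : Measurable G) (h : IndepFun F G P) :
    lpMean p P (fun ω => F ω * G ω) = lpMean p P F * lpMean p P G := by
  have hpow : Measurable fun x : ℝ≥0∞ => x ^ p := by fun_prop
  simp only [lpMean, ENNReal.mul_rpow_of_nonneg _ _ hp.le]
  rw [← ENNReal.mul_rpow_of_nonneg _ _ (by positivity)]
  congr 1
  exact lintegral_mul_eq_lintegral_mul_lintegral_of_indepFun (hpow.comp hF) (hpow.comp hG)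
    (h.comp hpow hpow)

theorem lpMean_average_le {p : ℝ} (hp : 1 ≤ p) {P : Measure Ω} {N : ℕ+} {F : Fin N → Ω → ℝ≥0∞}
    (hF : ∀ i, Measurable (F i)) {B : ℝ≥0∞} (h : ∀ i, lpMean p P (F i) ≤ B) :
    lpMean p P (fun ω => ((N : ℕ) : ℝ≥0∞)⁻¹ * ∑ i, F i ω) ≤ B := by
  have hp0 : 0 < p := by linarith
  have hpow : Measurable fun x : ℝ≥0∞ => x ^ p := by fun_prop
  have hFp : ∀ i, Measurable fun ω => F i ω ^ p := fun i => hpow.comp (hF i)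
  rw [lpMean_le_iff hp0]
  calc _ ≤ ∫⁻ ω, ((N : ℕ) : ℝ≥0∞)⁻¹ * ∑ i, F i ω ^ p ∂P := by
        refine lintegral_mono fun ω => ?_
        simp only [Finset.mul_sum]
        refine ENNReal.rpow_arith_mean_le_arith_mean_rpow Finset.univ _ _ ?_ hp
        simpa [mul_comm] using inv_natCast_mul_sum_const N 1
    _ = ((N : ℕ) : ℝ≥0∞)⁻¹ * ∑ i, ∫⁻ ω, F i ω ^ p ∂P := by
        rw [lintegral_const_mul _ (Finset.measurable_sum _ fun i _ => hFp i),
          lintegral_finsetSum _ fun i _ => hFp i]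
    _ ≤ ((N : ℕ) : ℝ≥0∞)⁻¹ * ∑ _i : Fin N, B ^ p := by
        gcongr with i
        exact (lpMean_le_iff hp0).1 (h i)
    _ = B ^ p := inv_natCast_mul_sum_const N _

theorem lintegral_rpow_lt_top_of_le {P : Measure Ω} [IsProbabilityMeasure P] {F : Ω → ℝ≥0∞}
    {p r : ℝ} (hp : 0 ≤ p) (hpr : p ≤ r) (h : ∫⁻ ω, F ω ^ r ∂P < ∞) : ∫⁻ ω, F ω ^ p ∂P < ∞ := by
  calc ∫⁻ ω, F ω ^ p ∂P ≤ ∫⁻ ω, (1 + F ω ^ r) ∂P := lintegral_mono fun ω => by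
        rcases le_total (F ω) 1 with h1 | h1
        · exact le_add_right (ENNReal.rpow_le_one h1 hp)
        · exact le_add_left (ENNReal.rpow_le_rpow_of_exponent_le h1 hpr)
    _ = 1 + ∫⁻ ω, F ω ^ r ∂P := by rw [lintegral_add_left measurable_const]; simp
    _ < ∞ := ENNReal.add_lt_top.2 ⟨by simp, h⟩

/-- The `L^p` norm is right-continuous at `p = 1` in the presence of higher moments. -/
theorem exists_lpMean_le {P : Measure Ω} [IsProbabilityMeasure P] {F : Ω → ℝ≥0∞}
    (hF : Measurable F) {α : ℝ} (hα : 0 < α) (hmom : ∫⁻ ω, F ω ^ (1 + α) ∂P < ∞) {s : ℝ≥0∞}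
    (hs : ∫⁻ ω, F ω ∂P < s) (hst : s ≠ ∞) :
    ∃ p : ℝ, 1 < p ∧ p ≤ 1 + α ∧ lpMean p P F ≤ s := by
  have hs0 : 0 < s := zero_le.trans_lt hs
  have hF1 : ∀ᵐ ω ∂P, F ω < ∞ := by
    refine ae_lt_top hF ?_
    exact (hs.trans_le le_top).ne
  have h1 : Tendsto (fun p : ℝ => ∫⁻ ω, F ω ^ p ∂P) (𝓝[>] 1) (𝓝 (∫⁻ ω, F ω ^ (1 : ℝ) ∂P)) := by
    refine tendsto_lintegral_filter_of_dominated_convergence (fun ω => 1 + F ω ^ (1 + α))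
      (Eventually.of_forall fun p => hF.pow_const p) ?_ ?_ ?_
    · have hmem : Set.Ioo 1 (1 + α) ∈ 𝓝[>] (1 : ℝ) := Ioo_mem_nhdsGT (by linarith)
      filter_upwards [hmem] with p hp
      refine Eventually.of_forall fun ω => ?_
      rcases le_total (F ω) 1 with h1 | h1
      · exact le_add_right (ENNReal.rpow_le_one h1 (by linarith [hp.1]))
      · exact le_add_left (ENNReal.rpow_le_rpow_of_exponent_le h1 hp.2.le)
    · rw [lintegral_add_left measurable_const]
      simpa using hmom.ne
    · filter_upwards [hF1] with ω hω
      have hc : Tendsto (fun p : ℝ => (F ω).toReal ^ p) (𝓝[>] 1) (𝓝 ((F ω).toReal ^ (1 : ℝ))) :=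
        (Real.continuousAt_const_rpow' one_ne_zero).continuousWithinAt
      have hc' := (ENNReal.continuous_ofReal.tendsto _).comp hc
      rw [← ENNReal.ofReal_rpow_of_nonneg ENNReal.toReal_nonneg zero_le_one,
        ENNReal.ofReal_toReal hω.ne] at hc'
      refine hc'.congr' (eventually_mem_nhdsWithin.mono fun p (hp : 1 < p) => ?_)
      simp only [Function.comp]
      rw [← ENNReal.ofReal_rpow_of_nonneg ENNReal.toReal_nonneg (by linarith),
        ENNReal.ofReal_toReal hω.ne]
  have h2 : Tendsto (fun p : ℝ => s ^ p) (𝓝[>] 1) (𝓝 (s ^ (1 : ℝ))) := by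
    have hsr : 0 < s.toReal := ENNReal.toReal_pos hs0.ne' hst
    have hc : Tendsto (fun p : ℝ => s.toReal ^ p) (𝓝[>] 1) (𝓝 (s.toReal ^ (1 : ℝ))) :=
      (Real.continuousAt_const_rpow' one_ne_zero).continuousWithinAt
    have hc' := (ENNReal.continuous_ofReal.tendsto _).comp hc
    simp only [Function.comp_def, ← ENNReal.ofReal_rpow_of_pos hsr,
      ENNReal.ofReal_toReal hst] at hc'
    exact hc'
  simp only [ENNReal.rpow_one] at h1 h2
  have hmem : Set.Ioo 1 (1 + α) ∈ 𝓝[>] (1 : ℝ) := Ioo_mem_nhdsGT (by linarith)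
  obtain ⟨p, hlt, hp⟩ := ((h1.eventually_lt h2 hs).and hmem).exists
  exact ⟨p, hp.1, hp.2.le, (lpMean_le_iff (by linarith [hp.1])).2 hlt.le⟩

end LpMean

theorem tailNorm_mul_rpow_le {d : ℕ} {R p : ℝ} (hp : 1 ≤ p) (x : Euc d) :
    tailNorm R x * ENNReal.ofReal R ^ (p - 1) ≤ ‖x‖ₑ ^ p := by
  by_cases hx : R < ‖x‖
  · rw [tailNorm, Set.indicator_of_mem (by exact hx)]
    calc _ ≤ ‖x‖ₑ * ‖x‖ₑ ^ (p - 1) := by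
          gcongr
          rw [← ofReal_norm]; exact ENNReal.ofReal_le_ofReal hx.le
      _ = ‖x‖ₑ ^ p := by
          conv_lhs => enter [1]; rw [← ENNReal.rpow_one ‖x‖ₑ]
          rw [← ENNReal.rpow_add_of_nonneg _ _ zero_le_one (by linarith)]
          congr 1; ring
  · rw [tailNorm, Set.indicator_of_notMem (by exact hx), zero_mul]
    exact zero_le

theorem exists_tailNorm_le {B : ℝ≥0∞} (hB : B ≠ ∞) {p : ℝ} (hp : 1 < p) {η : ℝ} (hη : 0 < η) :
    ∃ R : ℝ, ∀ {d : ℕ} {Ω : Type*} [MeasurableSpace Ω] (P : Measure Ω) (Y : Ω → Euc d),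
      lpMean p P (fun ω => ‖Y ω‖ₑ) ≤ B → ∫⁻ ω, tailNorm R (Y ω) ∂P ≤ ENNReal.ofReal η := by
  have hBp : B ^ p ≠ ∞ := ENNReal.rpow_ne_top_of_nonneg (by linarith) hB
  obtain ⟨R, hR0, hR⟩ := ((eventually_gt_atTop (0 : ℝ)).and
    ((tendsto_rpow_atTop (sub_pos.2 hp)).eventually_ge_atTop ((B ^ p).toReal / η))).exists
  refine ⟨R, fun P Y hY => ?_⟩
  have hRp : ENNReal.ofReal R ^ (p - 1) ≠ 0 := by
    simp [ENNReal.rpow_eq_zero_iff, hR0]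
  have hRt : ENNReal.ofReal R ^ (p - 1) ≠ ∞ :=
    ENNReal.rpow_ne_top_of_nonneg (by linarith) ENNReal.ofReal_ne_top
  have hBR : B ^ p ≤ ENNReal.ofReal η * ENNReal.ofReal R ^ (p - 1) := by
    rw [ENNReal.ofReal_rpow_of_pos hR0, ← ENNReal.ofReal_mul hη.le, ← ENNReal.ofReal_toReal hBp]
    refine ENNReal.ofReal_le_ofReal ?_
    rw [div_le_iff₀ hη] at hR
    linarith
  rw [← ENNReal.mul_le_mul_iff_left hRp hRt]
  refine le_trans ?_ hBR
  rw [← lintegral_mul_const' _ _ hRt]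
  exact (lintegral_mono fun ω => tailNorm_mul_rpow_le hp.le (Y ω)).trans
    ((lpMean_le_iff (by linarith)).1 hY)

theorem lpMean_map {Ω Ω' : Type*} [MeasurableSpace Ω] [MeasurableSpace Ω'] {p : ℝ} {P : Measure Ω}
    {g : Ω → Ω'} (hg : Measurable g) {F : Ω' → ℝ≥0∞} (hF : Measurable F) :
    lpMean p (P.map g) F = lpMean p P (fun ω => F (g ω)) := by
  have hpow : Measurable fun x => F x ^ p := hF.pow_const p
  rw [lpMean, lpMean, lintegral_map hpow hg]

namespace MeanFieldModel

variable {d m : ℕ} (M : MeanFieldModel d m) {N : ℕ+}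

theorem measurable_step_right (ρ : ProbabilityMeasure (Euc d)) (y : Euc d) :
    Measurable (M.step y ρ) := by
  have h1 : Measurable fun z : Euc m => (y, z) := measurable_prodMk_left
  have h := (M.measurable_step ρ).comp h1
  exact h

theorem Psi_empirical (x : Fin N → Euc d) :
    (M.Psi (empirical x) : Measure (Euc d)) = ((N : ℕ) : ℝ≥0∞)⁻¹ •
      ∑ i, (M.θ : Measure (Euc m)).map (M.step (x i) (empirical x)) := by
  have hst := M.measurable_step (empirical x)
  have hi : ∀ y, Measurable (M.step y (empirical x)) := M.measurable_step_right (empirical x)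
  refine Measure.ext_of_lintegral _ fun h hh => ?_
  have hhs : Measurable fun p : Euc d × Euc m => h (M.step p.1 (empirical x) p.2) := hh.comp hst
  rw [Psi, transport, ProbabilityMeasure.toMeasure_map, ProbabilityMeasure.toMeasure_prod,
    lintegral_map hh hst, lintegral_prod _ hhs.aemeasurable,
    lintegral_empirical x hhs.lintegral_prod_right', lintegral_smul_measure,
    lintegral_finsetSum_measure, smul_eq_mul]
  congr 1
  exact Finset.sum_congr rfl fun i _ => (lintegral_map hh (hi _)).symm

theorem measurable_W1_stepAll (hD : AEMeasurable M.D (M.θ : Measure (Euc m))) (hσ : M.σ ≠ ∞) :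
    Measurable fun p : (Fin N → Euc d) × (Fin N → Euc m) =>
      W1 (empirical (M.stepAll p.1 p.2)) (M.Psi (empirical p.1)) := by
  have hc : Continuous fun q : (Fin N → Euc d) × (Fin N → Euc d) =>
      W1 (empirical q.1) (M.Psi (empirical q.2)) := by
    refine continuous_of_le_add_edist (1 + M.rate)
      (ENNReal.add_ne_top.2 ⟨by simp, M.rate_ne_top hσ⟩) fun q q' => ?_
    calc W1 (empirical q.1) (M.Psi (empirical q.2)) ≤ W1 (empirical q.1) (empirical q'.1) +
          (W1 (empirical q'.1) (M.Psi (empirical q'.2)) +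
            W1 (M.Psi (empirical q'.2)) (M.Psi (empirical q.2))) :=
          (W1_triangle _ _ _).trans (add_le_add le_rfl (W1_triangle _ _ _))
      _ ≤ edist q q' + (W1 (empirical q'.1) (M.Psi (empirical q'.2)) +
          M.rate * edist q q') := by
          gcongr
          · exact (W1_empirical_le_edist _ _).trans (le_max_left _ _)
          · refine (M.W1_Psi_le hD hσ (hasFirstMoment_empirical _)
              (hasFirstMoment_empirical _)).trans ?_
            gcongr
            refine (W1_empirical_le_edist _ _).trans ?_
            rw [edist_comm]
            exact le_max_right _ _
      _ = _ := by ring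
  have h := hc.measurable.comp (M.measurable_stepAll.prodMk (measurable_fst
    (α := Fin N → Euc d) (β := Fin N → Euc m)))
  exact h

variable {Ω : Type*} [MeasurableSpace Ω] {P : Measure Ω} [IsProbabilityMeasure P]
  {X₀ : Fin N → Ω → Euc d} {ξ : ℕ → Fin N → Ω → Euc m}

theorem lpMean_state_le (hX₀ : ∀ i, Measurable (X₀ i)) (hξ : ∀ k i, Measurable (ξ k i))
    (hlaw : ∀ k i, P.map (ξ k i) = (M.θ : Measure (Euc m)))
    (hind : iIndepFun (fun p : ℕ × Fin N => ξ p.1 p.2) P)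
    (hind₀ : IndepFun (fun ω i => X₀ i ω) (fun ω (p : ℕ × Fin N) => ξ p.1 p.2 ω) P)
    (hD : AEMeasurable M.D (M.θ : Measure (Euc m))) (hσ : M.σ ≠ ∞) {p : ℝ} (hp : 1 ≤ p)
    {D' : Euc m → ℝ≥0∞} (hD' : Measurable D') (hDD' : M.D =ᵐ[(M.θ : Measure (Euc m))] D')
    {s B : ℝ≥0∞} (hs : lpMean p (M.θ : Measure (Euc m)) D' ≤ s)
    (hB : ‖M.opA‖ₑ * B + ‖M.δ‖ₑ * (s * (B + B) + lpMean p (M.θ : Measure (Euc m)) M.D₁) ≤ B)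
    (h₀ : ∀ i, lpMean p P (fun ω => ‖X₀ i ω‖ₑ) ≤ B) (n : ℕ) (i : Fin N) :
    lpMean p P (fun ω => ‖M.state X₀ ξ n ω i‖ₑ) ≤ B := by
  have hp0 : 0 < p := by linarith
  induction n generalizing i with
  | zero => exact h₀ i
  | succ n ih =>
    set X := M.state X₀ ξ n
    have hXm : Measurable X := M.measurable_state hX₀ hξ n
    have hXi : ∀ j, Measurable fun ω => ‖X ω j‖ₑ := fun j => by fun_prop
    set avg : (Fin N → Euc d) → ℝ≥0∞ := fun x => ((N : ℕ) : ℝ≥0∞)⁻¹ * ∑ j, ‖x j‖ₑ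
    have havg : Measurable avg := by fun_prop
    have hae : ∀ᵐ ω ∂P, M.D (ξ n i ω) = D' (ξ n i ω) ∧ M.D (ξ n i ω) ≠ ∞ := by
      have h := hDD'.and (M.ae_D_ne_top hD hσ)
      rw [← hlaw n i] at h
      exact ae_of_ae_map (hξ n i).aemeasurable h
    have hind' : IndepFun (fun ω => D' (ξ n i ω)) (fun ω => ‖X ω i‖ₑ + avg (X ω)) P := by
      have h := (M.indepFun_state hX₀ hξ hind hind₀ n).symm
      exact h.comp (φ := fun z : Fin N → Euc m => D' (z i))
        (ψ := fun x : Fin N → Euc d => ‖x i‖ₑ + avg x) (by fun_prop) (by fun_prop)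
    have hDξ : Measurable fun ω => D' (ξ n i ω) := hD'.comp (hξ n i)
    have hD₁ξ : Measurable fun ω => M.D₁ (ξ n i ω) := M.measurable_D₁.comp (hξ n i)
    have hsum : Measurable fun ω => ‖X ω i‖ₑ + avg (X ω) := (hXi i).add (havg.comp hXm)
    have hsumB : lpMean p P (fun ω => ‖X ω i‖ₑ + avg (X ω)) ≤ B + B :=
      (lpMean_add_le hp (hXi i).aemeasurable (havg.comp hXm).aemeasurable).trans
        (add_le_add (ih i) (lpMean_average_le hp hXi ih))
    have hDs : lpMean p P (fun ω => D' (ξ n i ω)) ≤ s := by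
      rw [← lpMean_map (hξ n i) hD', hlaw]; exact hs
    have hD₁s : lpMean p P (fun ω => M.D₁ (ξ n i ω)) = lpMean p (M.θ : Measure (Euc m)) M.D₁ := by
      rw [← lpMean_map (hξ n i) M.measurable_D₁, hlaw]
    calc lpMean p P (fun ω => ‖M.state X₀ ξ (n + 1) ω i‖ₑ)
        ≤ lpMean p P (fun ω => ‖M.opA‖ₑ * ‖X ω i‖ₑ + ‖M.δ‖ₑ *
          (D' (ξ n i ω) * (‖X ω i‖ₑ + avg (X ω)) + M.D₁ (ξ n i ω))) := by
          refine lpMean_mono_ae hp0.le (hae.mono fun ω hω => ?_)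
          have h := M.enorm_step_le hω.2 (X ω i) (hasFirstMoment_empirical (X ω))
          rw [firstMoment, lintegral_empirical _ (by fun_prop), hω.1] at h
          exact h
      _ ≤ ‖M.opA‖ₑ * lpMean p P (fun ω => ‖X ω i‖ₑ) + ‖M.δ‖ₑ *
          (lpMean p P (fun ω => D' (ξ n i ω)) * lpMean p P (fun ω => ‖X ω i‖ₑ + avg (X ω)) +
            lpMean p P (fun ω => M.D₁ (ξ n i ω))) := by
          rw [← lpMean_const_mul hp0 enorm_ne_top, ← lpMean_mul_of_indepFun hp0 hDξ hsum hind']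
          refine (lpMean_add_le hp ((hXi i).const_mul _).aemeasurable
            (((hDξ.mul hsum).add hD₁ξ).const_mul _).aemeasurable).trans ?_
          gcongr
          refine (lpMean_const_mul hp0 enorm_ne_top _).trans_le ?_
          gcongr
          exact lpMean_add_le hp (hDξ.mul hsum).aemeasurable hD₁ξ.aemeasurable
      _ ≤ ‖M.opA‖ₑ * B + ‖M.δ‖ₑ * (s * (B + B) + lpMean p (M.θ : Measure (Euc m)) M.D₁) := by
          rw [hD₁s]
          gcongr
          exact ih i
      _ ≤ B := hB

theorem expectedW1_succ_le (hX₀ : ∀ i, Measurable (X₀ i)) (hξ : ∀ k i, Measurable (ξ k i))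
    (hlaw : ∀ k i, P.map (ξ k i) = (M.θ : Measure (Euc m)))
    (hind : iIndepFun (fun p : ℕ × Fin N => ξ p.1 p.2) P)
    (hind₀ : IndepFun (fun ω i => X₀ i ω) (fun ω (p : ℕ × Fin N) => ξ p.1 p.2 ω) P)
    (hD : AEMeasurable M.D (M.θ : Measure (Euc m))) (hσ : M.σ ≠ ∞)
    (hD₁ : ∫⁻ z, M.D₁ z ∂(M.θ : Measure (Euc m)) ≠ ∞) {μ₀ : ProbabilityMeasure (Euc d)}
    (hμ₀ : HasFirstMoment μ₀) {R : ℝ} {η τ : ℝ≥0∞}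
    (hlln : ∀ x : Fin N → Euc d, ∫⁻ z, W1 (empirical (M.stepAll x z)) (M.Psi (empirical x))
        ∂(Measure.pi fun _ : Fin N => (M.θ : Measure (Euc m))) ≤
      η + 2 * ∫⁻ y, tailNorm R y ∂(M.Psi (empirical x) : Measure (Euc d)))
    (hτ : ∀ n i, ∫⁻ ω, tailNorm R (M.state X₀ ξ n ω i) ∂P ≤ τ) (n : ℕ) :
    M.expectedW1 P μ₀ X₀ ξ (n + 1) ≤ M.rate * M.expectedW1 P μ₀ X₀ ξ n + (η + 2 * τ) := by
  set X := M.state X₀ ξ n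
  set Q := Measure.pi fun _ : Fin N => (M.θ : Measure (Euc m))
  have hF := M.measurable_W1_stepAll (N := N) hD hσ
  have hXm : Measurable X := M.measurable_state hX₀ hξ n
  have hC : Measurable fun ω i => ξ n i ω := measurable_pi_lambda _ fun i => hξ _ _
  have hFω : Measurable fun ω => W1 (empirical (M.stepAll (X ω) fun i => ξ n i ω))
      (M.Psi (empirical (X ω))) := by
    have h := hF.comp (hXm.prodMk hC)
    exact h
  have htail : ∫⁻ ω, ∫⁻ y, tailNorm R y ∂(M.Psi (empirical (X ω)) : Measure (Euc d)) ∂P ≤ τ := by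
    have ht := measurable_tailNorm (d := d) R
    set G : (Fin N → Euc d) × (Fin N → Euc m) → ℝ≥0∞ := fun p =>
      ((N : ℕ) : ℝ≥0∞)⁻¹ * ∑ i, tailNorm R (M.stepAll p.1 p.2 i)
    have hGi : ∀ i, Measurable fun p : (Fin N → Euc d) × (Fin N → Euc m) =>
        tailNorm R (M.stepAll p.1 p.2 i) := fun i =>
      ht.comp ((measurable_pi_apply i).comp M.measurable_stepAll)
    have hG : Measurable G := (Finset.measurable_sum _ fun i _ => hGi i).const_mul _
    have h1 : ∀ x : Fin N → Euc d,
        ∫⁻ y, tailNorm R y ∂(M.Psi (empirical x) : Measure (Euc d)) = ∫⁻ z, G (x, z) ∂Q :=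
      fun x => by
        have hi : ∀ i : Fin N, Measurable (M.step (x i) (empirical x)) := fun i =>
          M.measurable_step_right (empirical x) (x i)
        rw [← lintegral_pi_lintegral_empirical (M.θ : Measure (Euc m)) hi (M.Psi_empirical x) ht]
        refine lintegral_congr fun z => ?_
        rw [lintegral_empirical _ ht]
        rfl
    simp only [h1]
    rw [← M.lintegral_state_noise hX₀ hξ hlaw hind hind₀ n hG]
    have hti : ∀ i, Measurable fun ω => tailNorm R (M.state X₀ ξ (n + 1) ω i) := fun i =>
      ht.comp ((measurable_pi_apply i).comp (M.measurable_state hX₀ hξ (n + 1)))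
    calc _ = ∫⁻ ω, ((N : ℕ) : ℝ≥0∞)⁻¹ * ∑ i, tailNorm R (M.state X₀ ξ (n + 1) ω i) ∂P := rfl
      _ = ((N : ℕ) : ℝ≥0∞)⁻¹ * ∑ i, ∫⁻ ω, tailNorm R (M.state X₀ ξ (n + 1) ω i) ∂P := by
          rw [lintegral_const_mul _ (Finset.measurable_sum _ fun i _ => hti i),
            lintegral_finsetSum _ fun i _ => hti i]
      _ ≤ ((N : ℕ) : ℝ≥0∞)⁻¹ * ∑ _i : Fin N, τ := by
          gcongr with i
          exact hτ (n + 1) i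
      _ = τ := inv_natCast_mul_sum_const N τ
  calc M.expectedW1 P μ₀ X₀ ξ (n + 1)
      ≤ ∫⁻ ω, (W1 (empirical (M.stepAll (X ω) fun i => ξ n i ω)) (M.Psi (empirical (X ω))) +
          M.rate * W1 (empirical (X ω)) (M.law μ₀ n)) ∂P := by
        refine lintegral_mono fun ω => (W1_triangle _ (M.Psi (empirical (X ω))) _).trans ?_
        exact add_le_add le_rfl (M.W1_Psi_le hD hσ (hasFirstMoment_empirical _)
          (M.hasFirstMoment_law hD hσ hD₁ hμ₀ n))
    _ = ∫⁻ ω, ∫⁻ z, W1 (empirical (M.stepAll (X ω) z)) (M.Psi (empirical (X ω))) ∂Q ∂P +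
          M.rate * M.expectedW1 P μ₀ X₀ ξ n := by
        rw [lintegral_add_left hFω, lintegral_const_mul' _ _ (M.rate_ne_top hσ)]
        congr 1
        exact M.lintegral_state_noise hX₀ hξ hlaw hind hind₀ n hF
    _ ≤ (η + 2 * τ) + M.rate * M.expectedW1 P μ₀ X₀ ξ n := by
        gcongr
        refine (lintegral_mono fun ω => hlln (X ω)).trans ?_
        rw [lintegral_add_left measurable_const, lintegral_const_mul' _ _ (by simp)]
        simp only [lintegral_const, measure_univ, mul_one]
        gcongr
    _ = _ := add_comm _ _

theorem expectedW1_zero_le (hX₀ : ∀ i, Measurable (X₀ i)) {μ₀ : ProbabilityMeasure (Euc d)}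
    (hlaw₀ : ∀ i, P.map (X₀ i) = (μ₀ : Measure (Euc d))) :
    M.expectedW1 P μ₀ X₀ ξ 0 ≤ 2 * firstMoment μ₀ := by
  have hXi : ∀ i, Measurable fun ω => ‖X₀ i ω‖ₑ := fun i => (hX₀ i).enorm
  have hi : ∀ i, ∫⁻ ω, ‖X₀ i ω‖ₑ ∂P = firstMoment μ₀ := fun i => by
    rw [firstMoment, ← hlaw₀ i, lintegral_map (by fun_prop) (hX₀ i)]
  calc M.expectedW1 P μ₀ X₀ ξ 0
      ≤ ∫⁻ ω, (((N : ℕ) : ℝ≥0∞)⁻¹ * ∑ i, ‖X₀ i ω‖ₑ + firstMoment μ₀) ∂P := by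
        refine lintegral_mono fun ω => (W1_le_firstMoment_add _ _).trans_eq ?_
        rw [firstMoment, lintegral_empirical _ (by fun_prop)]
        rfl
    _ = 2 * firstMoment μ₀ := by
        rw [lintegral_add_right _ measurable_const,
          lintegral_const_mul _ (Finset.measurable_sum _ fun i _ => hXi i),
          lintegral_finsetSum _ fun i _ => hXi i]
        simp only [hi, inv_natCast_mul_sum_const, lintegral_const, measure_univ, mul_one]
        ring

end MeanFieldModel

/-- A discrete Grönwall inequality for contractions. -/
theorem ENNReal.le_pow_mul_add_of_succ_le {u : ℕ → ℝ≥0∞} {c a : ℝ≥0∞} (hc : c ≤ 1)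
    (h : ∀ n, u (n + 1) ≤ c * u n + (1 - c) * a) (n : ℕ) : u n ≤ c ^ n * u 0 + a := by
  induction n with
  | zero => simp
  | succ n ih =>
    calc u (n + 1) ≤ c * (c ^ n * u 0 + a) + (1 - c) * a := (h n).trans (by gcongr)
      _ = c ^ (n + 1) * u 0 + (c + (1 - c)) * a := by ring
      _ = c ^ (n + 1) * u 0 + a := by rw [add_tsub_cancel_of_le hc, one_mul]

namespace MeanFieldModel

variable {d m : ℕ} (M : MeanFieldModel d m)

/-- Since `δ < a₀`, there is room between `σ` and the largest admissible Lipschitz modulus. -/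
theorem exists_sigma_lt_contraction {w : ℝ} (hw : 0 < w) (hA : ‖M.opA‖ ≤ Real.exp (-w))
    (hδ_pos : 0 < M.δ) (hδ_lt : ENNReal.ofReal M.δ < M.a₀ w) :
    ∃ s : ℝ≥0∞, M.σ < s ∧ s ≠ ∞ ∧ ‖M.opA‖ₑ + 2 * ‖M.δ‖ₑ * s < 1 := by
  have hδ : ‖M.δ‖ₑ = ENNReal.ofReal M.δ := Real.enorm_of_nonneg hδ_pos.le
  have hδ0 : ENNReal.ofReal M.δ ≠ 0 := (ENNReal.ofReal_pos.2 hδ_pos).ne'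
  have hexp : Real.exp (-w) ≤ 1 := Real.exp_le_one_iff.2 (by linarith)
  rw [a₀, ENNReal.lt_div_iff_mul_lt (Or.inr ENNReal.ofReal_ne_top) (Or.inr hδ0)] at hδ_lt
  have h2δ0 : 2 * ENNReal.ofReal M.δ ≠ 0 := mul_ne_zero two_ne_zero hδ0
  have h2δt : 2 * ENNReal.ofReal M.δ ≠ ∞ := ENNReal.mul_ne_top (by simp) ENNReal.ofReal_ne_top
  have hσ : M.σ < ENNReal.ofReal (1 - Real.exp (-w)) / (2 * ENNReal.ofReal M.δ) := by
    rw [ENNReal.lt_div_iff_mul_lt (Or.inl h2δ0) (Or.inl h2δt)]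
    refine lt_of_eq_of_lt ?_ hδ_lt
    ring
  obtain ⟨s, hs, hs'⟩ := exists_between hσ
  refine ⟨s, hs, (hs'.trans_le le_top).ne, ?_⟩
  rw [ENNReal.lt_div_iff_mul_lt (Or.inl h2δ0) (Or.inl h2δt)] at hs'
  have hA' : ‖M.opA‖ₑ ≤ ENNReal.ofReal (Real.exp (-w)) := by
    rw [← ofReal_norm]; exact ENNReal.ofReal_le_ofReal hA
  calc ‖M.opA‖ₑ + 2 * ‖M.δ‖ₑ * s
      < ENNReal.ofReal (Real.exp (-w)) + ENNReal.ofReal (1 - Real.exp (-w)) := by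
        refine ENNReal.add_lt_add_of_le_of_lt enorm_ne_top hA' ?_
        rwa [hδ, mul_comm]
    _ = 1 := by
        rw [← ENNReal.ofReal_add (Real.exp_pos _).le (by linarith)]
        simp

/-- The size of the ball that is invariant under the affine bound for the `p`-th moments. -/
theorem exists_moment_bound {s L K : ℝ≥0∞} (hs : ‖M.opA‖ₑ + 2 * ‖M.δ‖ₑ * s < 1) (hL : L ≠ ∞)
    (hK : K ≠ ∞) :
    ∃ B : ℝ≥0∞, B ≠ ∞ ∧ K ≤ B ∧ ‖M.opA‖ₑ * B + ‖M.δ‖ₑ * (s * (B + B) + L) ≤ B := by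
  set κ := ‖M.opA‖ₑ + 2 * ‖M.δ‖ₑ * s
  have hr0 : 1 - κ ≠ 0 := (tsub_pos_of_lt hs).ne'
  have hrt : 1 - κ ≠ ∞ := ENNReal.sub_ne_top ENNReal.one_ne_top
  have hκ : κ + (1 - κ) = 1 := add_tsub_cancel_of_le hs.le
  set B := K + (1 - κ)⁻¹ * (‖M.δ‖ₑ * L)
  refine ⟨B, ENNReal.add_ne_top.2 ⟨hK, ENNReal.mul_ne_top (ENNReal.inv_ne_top.2 hr0)
    (ENNReal.mul_ne_top enorm_ne_top hL)⟩, le_self_add, ?_⟩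
  calc ‖M.opA‖ₑ * B + ‖M.δ‖ₑ * (s * (B + B) + L) = κ * B + ‖M.δ‖ₑ * L := by
        simp only [κ]; ring
    _ = κ * B + (1 - κ) * ((1 - κ)⁻¹ * (‖M.δ‖ₑ * L)) := by
        rw [← mul_assoc (1 - κ), ENNReal.mul_inv_cancel hr0 hrt, one_mul]
    _ ≤ κ * B + (1 - κ) * B := by
        gcongr
        exact le_add_self
    _ = B := by rw [← add_mul, hκ, one_mul]

end MeanFieldModel

theorem theorem3p4 {d m : ℕ} (M : MeanFieldModel d m) (μ₀ : ProbabilityMeasure (Euc d))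
    -- for every `N ≥ 1`: a probability space with the initial positions and the noise array
    (Ω : ℕ+ → Type*) [∀ N, MeasurableSpace (Ω N)]
    (P : ∀ N, Measure (Ω N)) [∀ N, IsProbabilityMeasure (P N)]
    (X₀ : ∀ N : ℕ+, Fin N → Ω N → Euc d) (ξ : ∀ N : ℕ+, ℕ → Fin N → Ω N → Euc m)
    -- the initial positions are exchangeable with common law `μ₀`
    (hX₀_meas : ∀ N i, Measurable (X₀ N i))
    (hX₀_exch : ∀ N, IsExchangeable (P N) (X₀ N))
    (hX₀_law : ∀ N i, (P N).map (X₀ N i) = (μ₀ : Measure (Euc d)))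
    -- the noise is i.i.d. with law `θ` and independent of the initial positions
    (hξ_meas : ∀ N k i, Measurable (ξ N k i))
    (hξ_law : ∀ N k i, (P N).map (ξ N k i) = (M.θ : Measure (Euc m)))
    (hξ_indep : ∀ N : ℕ+, iIndepFun (fun (p : ℕ × Fin N) => ξ N p.1 p.2) (P N))
    (hξX₀_indep : ∀ N : ℕ+,
      IndepFun (fun ω i => X₀ N i ω) (fun ω (p : ℕ × Fin N) => ξ N p.1 p.2 ω) (P N))
    -- contractivity of `A`
    (w : ℝ) (hw : 0 < w) (hA : ‖M.opA‖ ≤ Real.exp (-w))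
    -- moments of order `1 + α`
    (α : ℝ) (hα : 0 < α)
    (hX₀_mom : ∀ N i, ∫⁻ ω, ‖X₀ N i ω‖ₑ ^ (1 + α) ∂(P N) < ∞)
    (hD_meas : AEMeasurable M.D (M.θ : Measure (Euc m)))
    (hD_mom : ∫⁻ z, M.D z ^ (1 + α) ∂(M.θ : Measure (Euc m)) < ∞)
    (hD₁_mom : ∫⁻ z, M.D₁ z ^ (1 + α) ∂(M.θ : Measure (Euc m)) < ∞)
    -- `δ ∈ (0, a₀)`
    (hδ_pos : 0 < M.δ) (hδ_lt : ENNReal.ofReal M.δ < M.a₀ w) :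
    (∀ ε : ℝ, 0 < ε → ∃ (N₀ : ℕ+) (n₀ : ℕ), ∀ (n : ℕ) (N : ℕ+), n₀ ≤ n → N₀ ≤ N →
      M.expectedW1 (P N) μ₀ (X₀ N) (ξ N) n < ENNReal.ofReal ε) ∧
    (Tendsto (fun N : ℕ+ => M.expectedW1 (P N) μ₀ (X₀ N) (ξ N) 0) atTop (𝓝 0) →
      Tendsto (fun N : ℕ+ => ⨆ (n : ℕ) (_ : 1 ≤ n), M.expectedW1 (P N) μ₀ (X₀ N) (ξ N) n)
        atTop (𝓝 0)) := by
  obtain ⟨s, hσs, hst, hs1⟩ := M.exists_sigma_lt_contraction hw hA hδ_pos hδ_lt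
  have hσ : M.σ ≠ ∞ := (hσs.trans_le le_top).ne
  have hrate : M.rate < 1 := lt_of_le_of_lt (by unfold MeanFieldModel.rate; gcongr) hs1
  -- an exponent `p > 1` for which the affine bound on the `p`-th moments still contracts
  obtain ⟨D', hD', hDD'⟩ := hD_meas
  have hD_meas : AEMeasurable M.D (M.θ : Measure (Euc m)) := ⟨D', hD', hDD'⟩
  have hD'_mom : ∫⁻ z, D' z ^ (1 + α) ∂(M.θ : Measure (Euc m)) < ∞ := by
    have h : ∫⁻ z, M.D z ^ (1 + α) ∂(M.θ : Measure (Euc m)) =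
        ∫⁻ z, D' z ^ (1 + α) ∂(M.θ : Measure (Euc m)) :=
      lintegral_congr_ae (hDD'.mono fun z hz => by simp only [hz])
    rwa [← h]
  have hD's : ∫⁻ z, D' z ∂(M.θ : Measure (Euc m)) < s := by
    rwa [← lintegral_congr_ae hDD']
  obtain ⟨p, hp1, hpα, hps⟩ := exists_lpMean_le hD' hα hD'_mom hD's hst
  have hp0 : 0 < p := by linarith
  have hnorm : Measurable fun x : Euc d => ‖x‖ₑ := by fun_prop
  have hD₁p : lpMean p (M.θ : Measure (Euc m)) M.D₁ ≠ ∞ :=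
    ENNReal.rpow_ne_top_of_nonneg (by positivity)
      (lintegral_rpow_lt_top_of_le hp0.le hpα hD₁_mom).ne
  have hD₁ : ∫⁻ z, M.D₁ z ∂(M.θ : Measure (Euc m)) ≠ ∞ := by
    have h := (lintegral_rpow_lt_top_of_le zero_le_one (by linarith) hD₁_mom).ne
    simpa using h
  have hμ₀_mom : ∫⁻ x, ‖x‖ₑ ^ (1 + α) ∂(μ₀ : Measure (Euc d)) < ∞ := by
    have h := hX₀_mom 1 0
    rwa [← hX₀_law 1 0, lintegral_map (hnorm.pow_const _) (hX₀_meas 1 0)]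
  have hμ₀ : HasFirstMoment μ₀ := by
    have h := lintegral_rpow_lt_top_of_le zero_le_one (by linarith) hμ₀_mom
    simpa [HasFirstMoment] using h
  have hμ₀p : lpMean p (μ₀ : Measure (Euc d)) (fun x => ‖x‖ₑ) ≠ ∞ :=
    ENNReal.rpow_ne_top_of_nonneg (by positivity)
      (lintegral_rpow_lt_top_of_le hp0.le hpα hμ₀_mom).ne
  obtain ⟨B, hBt, hKB, hB⟩ := M.exists_moment_bound hs1 hD₁p hμ₀p
  have hmom : ∀ N n i, lpMean p (P N) (fun ω => ‖M.state (X₀ N) (ξ N) n ω i‖ₑ) ≤ B := fun N =>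
    M.lpMean_state_le (hX₀_meas N) (hξ_meas N) (hξ_law N) (hξ_indep N) (hξX₀_indep N) hD_meas hσ
      hp1.le hD' hDD' hps hB fun i => by
        rw [← lpMean_map (hX₀_meas N i) hnorm, hX₀_law N i]
        exact hKB
  -- the recursion for the expected distance, uniformly in time
  have hrec : ∀ ε : ℝ, 0 < ε → ∃ N₀ : ℕ+, ∀ N, N₀ ≤ N → ∀ n,
      M.expectedW1 (P N) μ₀ (X₀ N) (ξ N) n ≤
        M.rate ^ n * M.expectedW1 (P N) μ₀ (X₀ N) (ξ N) 0 + ENNReal.ofReal ε := fun ε hε => by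
    set r := (1 - M.rate).toReal
    have hrt : 1 - M.rate ≠ ∞ := ENNReal.sub_ne_top ENNReal.one_ne_top
    have hr : 0 < r := ENNReal.toReal_pos (tsub_pos_of_lt hrate).ne' hrt
    have hη : 0 < r * ε / 3 := by positivity
    obtain ⟨R, hR⟩ := exists_tailNorm_le hBt hp1 hη
    obtain ⟨N₀, hN₀⟩ := exists_lintegral_W1_empirical_le d R hη
    refine ⟨N₀, fun N hN => ENNReal.le_pow_mul_add_of_succ_le hrate.le fun n => ?_⟩
    refine (M.expectedW1_succ_le (hX₀_meas N) (hξ_meas N) (hξ_law N) (hξ_indep N) (hξX₀_indep N)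
      hD_meas hσ hD₁ hμ₀
      (fun x => hN₀ N hN (M.θ : Measure (Euc m))
        (fun i => M.measurable_step_right (empirical x) (x i)) (M.Psi_empirical x))
      (fun n i => hR (P N) _ (hmom N n i)) n).trans_eq ?_
    congr 1
    rw [← ENNReal.ofReal_toReal hrt, ← ENNReal.ofReal_mul ENNReal.toReal_nonneg,
      ← ENNReal.ofReal_ofNat, ← ENNReal.ofReal_mul (by norm_num),
      ← ENNReal.ofReal_add hη.le (by positivity)]
    congr 1
    ring
  refine ⟨fun ε hε => ?_, fun h₀ => ?_⟩
  · obtain ⟨N₀, hN₀⟩ := hrec (ε / 2) (half_pos hε)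
    have hKt : 2 * firstMoment μ₀ ≠ ∞ :=
      ENNReal.mul_ne_top (by simp) (show firstMoment μ₀ < ∞ from hμ₀).ne
    have hlim : Tendsto (fun n => M.rate ^ n * (2 * firstMoment μ₀)) atTop (𝓝 0) := by
      simpa using ENNReal.Tendsto.mul_const
        (ENNReal.tendsto_pow_atTop_nhds_zero_of_lt_one hrate) (Or.inr hKt)
    obtain ⟨n₀, hn₀⟩ := eventually_atTop.1
      (hlim.eventually_lt_const (ENNReal.ofReal_pos.2 (half_pos hε)))
    refine ⟨N₀, n₀, fun n N hn hN => ?_⟩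
    calc _ ≤ M.rate ^ n * M.expectedW1 (P N) μ₀ (X₀ N) (ξ N) 0 + ENNReal.ofReal (ε / 2) :=
          hN₀ N hN n
      _ ≤ M.rate ^ n * (2 * firstMoment μ₀) + ENNReal.ofReal (ε / 2) := by
          gcongr
          exact M.expectedW1_zero_le (hX₀_meas N) (hX₀_law N)
      _ < ENNReal.ofReal (ε / 2) + ENNReal.ofReal (ε / 2) :=
          ENNReal.add_lt_add_right ENNReal.ofReal_ne_top (hn₀ n hn)
      _ = ENNReal.ofReal ε := by
          rw [← ENNReal.ofReal_add (by positivity) (by positivity), add_halves]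
  · refine ENNReal.tendsto_nhds_zero.2 fun ε hε => ?_
    obtain ⟨e, he0, heε⟩ := ENNReal.lt_iff_exists_nnreal_btwn.1 hε
    have he : (0 : ℝ) < e := by exact_mod_cast he0
    obtain ⟨N₀, hN₀⟩ := hrec (e / 2) (half_pos he)
    have hhalf : (0 : ℝ≥0∞) < ENNReal.ofReal (e / 2) := ENNReal.ofReal_pos.2 (half_pos he)
    filter_upwards [eventually_ge_atTop N₀, h₀.eventually_le_const hhalf] with N hN h0N
    refine iSup₂_le fun n _ => (hN₀ N hN n).trans ?_
    calc _ ≤ 1 * ENNReal.ofReal (e / 2) + ENNReal.ofReal (e / 2) := by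
          gcongr
          exact pow_le_one₀ zero_le hrate.le
      _ = e := by
          rw [one_mul, ← ENNReal.ofReal_add (by positivity) (by positivity), add_halves,
            ENNReal.ofReal_coe_nnreal]
      _ ≤ ε := heε.le
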